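/- Let $p$ be an even integer, and let $U$ be a finite simple graph consisting of a cycle with $p$ vertices and a (nonempty) tree disjoint from it, together with exactly one edge joining a vertex of the cycle to a vertex of the tree. (So $p\ge 4$, exactly one vertex of the cycle has degree $3$ in $U$, and the other vertices of the cycle have degree $2$.) The distance squared matrix $\Delta(G)$ of a connected graph $G$ is the matrix indexed by its vertices with entries $\Delta(G)_{ij}=d(i,j)^2$, where $d$ is the graph distance. For a real symmetric matrix $M$, let $i_-(M)$ be the number of negative eigenvalues of $M$, counted with multiplicity, and $i_0(M)$ the multiplicity of $0$ as an eigenvalue of $M$. Put $\Delta=\Delta(U)$ and $q=i_-(\Delta(C_p))$, where $C_p$ is the cycle graph on $p$ vertices. Then $$i_-(\Delta)=\ell+q,\qquad q=\frac p2,\qquad i_0(\Delta)=t,$$ where $\ell$ is the number of leaves (vertices of degree $1$) of $U$, and $t$ is the number of vertices of degree $2$ of $U$ whose removal disconnects $U$. -/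

import Mathlib

/-- The distance squared matrix of a graph: its `(i, j)` entry is `d(i, j) ^ 2`. -/
noncomputable def distSqMatrix {V : Type*} (G : SimpleGraph V) : Matrix V V ℝ :=
  Matrix.of fun i j => (G.dist i j : ℝ) ^ 2

/-- `i₋(M)`: the number of negative eigenvalues of `M`, counted with (algebraic) multiplicity.
It is used for symmetric real matrices only, whose eigenvalues are all real. -/
noncomputable def negInertia {V : Type*} [Fintype V] [DecidableEq V] (M : Matrix V V ℝ) : ℕ :=
  (M.charpoly.roots.filter (fun x => x < 0)).card

/-- `i₀(M)`: the multiplicity of `0` as an eigenvalue of `M`. -/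
noncomputable def zeroInertia {V : Type*} [Fintype V] [DecidableEq V] (M : Matrix V V ℝ) : ℕ :=
  (M.charpoly.roots.filter (fun x => x = 0)).card

/-- `G` consists of a cycle with `p` vertices (`p ≥ 3`) and a tree (with at least one vertex), on
disjoint vertex sets `C` and `Cᶜ`, together with exactly one edge `v w` between a vertex `v` of the
cycle and a vertex `w` of the tree. -/
def IsCycleWithTree {V : Type*} (G : SimpleGraph V) (p : ℕ) : Prop :=
  3 ≤ p ∧ ∃ C : Set V,
    Nonempty (SimpleGraph.cycleGraph p ≃g G.induce C) ∧
    (G.induce Cᶜ).IsTree ∧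
    ∃ v ∈ C, ∃ w ∈ Cᶜ, ∀ x ∈ C, ∀ y ∈ Cᶜ, G.Adj x y ↔ x = v ∧ y = w

/-- The number of leaves (vertices of degree one). -/
noncomputable def numLeaves {V : Type*} [Fintype V] (G : SimpleGraph V) [DecidableRel G.Adj] : ℕ :=
  {v : V | G.degree v = 1}.ncard

/-- The number of vertices of degree two whose removal disconnects the graph. -/
noncomputable def numDegreeTwoCutVertices {V : Type*} [Fintype V] (G : SimpleGraph V)
    [DecidableRel G.Adj] : ℕ :=
  {v : V | G.degree v = 2 ∧ ¬ (G.induce {v}ᶜ).Preconnected}.ncard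

/-! Each of the three inertia counts is bounded below by exhibiting explicit vectors. The bounds add
up to at least the number of vertices, so all of them are equalities
(`IsCycleTreeModel.inertia_eq`). Write `p = 2m` and let `T` be the vertex set of the tree.

On the tree, take the Laplacian rows `L_i`, `i ∈ T`. From every other vertex, exactly one neighbour
of `i` is nearer and the rest are farther, so `Δ L_i = 2(2 - deg i) d(·, i) - deg i` and the Gram
matrix of these rows depends only on degrees (`lapRow_gram`). Up to correction by the sum of all
tree rows, leaves give negative directions. Vertices of degree at least 3 give positive ones. For
degree 2, `Δ L_i` is constant, which nearly gives a kernel vector.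

On the cycle, indicator differences along edges have Gram entries `-2`, increased by `4m` for
antipodal edges. Differences of antipodal pairs (odd flows) then give negative directions, and sums
(even flows) positive ones; in `U` each family contributes `m - 1`.

The remaining direction of each sign comes from a hyperbolic plane: a vector `x` of coordinate sum
zero with `Δ x` a nonzero constant (`pole`), and the indicator `u` of the attaching vertex, which is
isotropic. The same `x` turns the degree 2 rows into true kernel vectors. The totals are `m +
#leaves`, `m + #{i ∈ T | deg i ≥ 3}` and `#{i ∈ T | deg i = 2}`. -/

/-- The number of positive eigenvalues, counted with multiplicity. -/
noncomputable def posInertia {V : Type*} [Fintype V] [DecidableEq V] (M : Matrix V V ℝ) : ℕ :=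
  (M.charpoly.roots.filter (fun x => 0 < x)).card

/-! ### Inertia bounds from explicit vectors -/

section Inertia

open Matrix

variable {V : Type*} [Fintype V] [DecidableEq V]

set_option linter.unusedSectionVars false

theorem card_filter_roots_charpoly {M : Matrix V V ℝ} (hM : M.IsHermitian) (P : ℝ → Prop)
    [DecidablePred P] :
    (M.charpoly.roots.filter P).card = Fintype.card {i // P (hM.eigenvalues i)} := by
  have h := hM.roots_charpoly_eq_eigenvalues
  rw [h, Fintype.card_subtype, Multiset.filter_map, Multiset.card_map]
  rfl

theorem negInertia_add_zeroInertia_add_posInertia {M : Matrix V V ℝ} (hM : M.IsHermitian) :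
    negInertia M + zeroInertia M + posInertia M = Fintype.card V := by
  rw [negInertia, zeroInertia, posInertia, card_filter_roots_charpoly hM,
    card_filter_roots_charpoly hM, card_filter_roots_charpoly hM, Fintype.card_subtype,
    Fintype.card_subtype, Fintype.card_subtype, ← Finset.card_univ]
  rw [← Finset.card_union_of_disjoint, ← Finset.card_union_of_disjoint]
  · congr 1
    ext i
    simpa [or_assoc] using lt_trichotomy (hM.eigenvalues i) 0
  · rw [Finset.disjoint_left]
    intro i hi hi'
    simp only [Finset.mem_union, Finset.mem_filter, Finset.mem_univ, true_and] at hi hi'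
    rcases hi with hi | hi <;> linarith
  · rw [Finset.disjoint_left]
    intro i hi hi'
    simp only [Finset.mem_filter, Finset.mem_univ, true_and] at hi hi'
    linarith

theorem exists_orthogonal_diagonalization {M : Matrix V V ℝ} (hM : M.IsHermitian) :
    ∃ P : Matrix V V ℝ, P * Pᵀ = 1 ∧ M = P * diagonal hM.eigenvalues * Pᵀ := by
  refine ⟨hM.eigenvectorUnitary, ?_, ?_⟩
  · have := Unitary.mul_star_self_of_mem hM.eigenvectorUnitary.2
    rwa [star_eq_conjTranspose, conjTranspose_eq_transpose_of_trivial] at this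
  · have := hM.spectral_theorem
    rw [Unitary.conjStarAlgAut_apply, star_eq_conjTranspose,
      conjTranspose_eq_transpose_of_trivial] at this
    exact this

theorem quadForm_of_diagonalization (P : Matrix V V ℝ) (d : V → ℝ) (x : V → ℝ) :
    x ⬝ᵥ (P * diagonal d * Pᵀ) *ᵥ x = ∑ i, d i * (Pᵀ *ᵥ x) i ^ 2 := by
  rw [← mulVec_mulVec, ← mulVec_mulVec, dotProduct_mulVec, ← mulVec_transpose]
  simp only [dotProduct, mulVec_diagonal]
  exact Finset.sum_congr rfl fun i _ => by ring

/-- The dimension of a space on which a form is negative definite is at most the number of its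
negative weights. -/
theorem card_le_card_neg_weights (P : Matrix V V ℝ) (d : V → ℝ) {ι : Type*} [Fintype ι]
    (f : (ι → ℝ) →ₗ[ℝ] (V → ℝ))
    (hf : ∀ a, a ≠ 0 → f a ⬝ᵥ (P * diagonal d * Pᵀ) *ᵥ f a < 0) :
    Fintype.card ι ≤ Fintype.card {i // d i < 0} := by
  by_contra! hlt
  let g : (ι → ℝ) →ₗ[ℝ] ({i // d i < 0} → ℝ) :=
    (LinearMap.funLeft ℝ ℝ (Subtype.val : {i // d i < 0} → V)) ∘ₗ (Matrix.mulVecLin Pᵀ) ∘ₗ f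
  -- With too few negative weights, some nonzero `a` has all its negatively weighted coordinates
  -- zero, and there the form is nonnegative.
  obtain ⟨a, ha, ha0⟩ := (LinearMap.ker g).ne_bot_iff.mp
    (LinearMap.ker_ne_bot_of_finrank_lt (f := g) (by simpa using hlt))
  have h := hf a ha0
  rw [quadForm_of_diagonalization] at h
  refine absurd h (not_lt.mpr (Finset.sum_nonneg fun i _ => ?_))
  by_cases hi : d i < 0
  · have : (Pᵀ *ᵥ f a) i = 0 := congrFun ha ⟨i, hi⟩
    simp [this]
  · exact mul_nonneg (not_lt.mp hi) (sq_nonneg _)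

theorem sum_smul_quadForm (M : Matrix V V ℝ) {ι : Type*} [Fintype ι] (b : ι → V → ℝ)
    (a : ι → ℝ) :
    Fintype.linearCombination ℝ b a ⬝ᵥ M *ᵥ Fintype.linearCombination ℝ b a
      = ∑ i, ∑ j, a i * a j * (b i ⬝ᵥ M *ᵥ b j) := by
  simp only [Fintype.linearCombination_apply, sum_dotProduct, smul_dotProduct, smul_eq_mul,
    mulVec_sum, dotProduct_sum, mulVec_smul, dotProduct_smul, Finset.mul_sum]
  rw [Finset.sum_comm]
  exact Finset.sum_congr rfl fun i _ => Finset.sum_congr rfl fun j _ => by ring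

theorem card_le_negInertia {M : Matrix V V ℝ} (hM : M.IsHermitian) {ι : Type*} [Fintype ι]
    (b : ι → V → ℝ)
    (hb : ∀ a : ι → ℝ, a ≠ 0 → ∑ i, ∑ j, a i * a j * (b i ⬝ᵥ M *ᵥ b j) < 0) :
    Fintype.card ι ≤ negInertia M := by
  obtain ⟨P, -, hP⟩ := exists_orthogonal_diagonalization hM
  rw [negInertia, card_filter_roots_charpoly hM]
  refine card_le_card_neg_weights P _ (Fintype.linearCombination ℝ b) fun a ha => ?_
  rw [← hP, sum_smul_quadForm]
  exact hb a ha

theorem card_le_posInertia {M : Matrix V V ℝ} (hM : M.IsHermitian) {ι : Type*} [Fintype ι]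
    (b : ι → V → ℝ)
    (hb : ∀ a : ι → ℝ, a ≠ 0 → 0 < ∑ i, ∑ j, a i * a j * (b i ⬝ᵥ M *ᵥ b j)) :
    Fintype.card ι ≤ posInertia M := by
  obtain ⟨P, -, hP⟩ := exists_orthogonal_diagonalization hM
  rw [posInertia, card_filter_roots_charpoly hM]
  -- The same `P` diagonalises `-M`, on which the given span is negative definite.
  have key := card_le_card_neg_weights P (-hM.eigenvalues) (Fintype.linearCombination ℝ b)
    fun a ha => by
      rw [show -hM.eigenvalues = fun i => -hM.eigenvalues i from rfl, ← diagonal_neg, Matrix.mul_neg, Matrix.neg_mul, ← hP, neg_mulVec, dotProduct_neg,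
        sum_smul_quadForm]
      simpa using hb a ha
  simpa using key

theorem card_le_zeroInertia {M : Matrix V V ℝ} (hM : M.IsHermitian) {ι : Type*} [Fintype ι]
    (b : ι → V → ℝ) (hb : ∀ i, M *ᵥ b i = 0) (hli : LinearIndependent ℝ b) :
    Fintype.card ι ≤ zeroInertia M := by
  obtain ⟨P, hPP, hP⟩ := exists_orthogonal_diagonalization hM
  have hPP' : Pᵀ * P = 1 := mul_eq_one_comm.mp hPP
  rw [zeroInertia, card_filter_roots_charpoly hM]
  by_contra! hlt
  let f := Fintype.linearCombination ℝ b
  let g : (ι → ℝ) →ₗ[ℝ] ({i // hM.eigenvalues i = 0} → ℝ) :=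
    (LinearMap.funLeft ℝ ℝ (Subtype.val : {i // hM.eigenvalues i = 0} → V)) ∘ₗ
      (Matrix.mulVecLin Pᵀ) ∘ₗ f
  obtain ⟨a, ha, ha0⟩ := (LinearMap.ker g).ne_bot_iff.mp
    (LinearMap.ker_ne_bot_of_finrank_lt (f := g) (by simpa using hlt))
  have h0 : M *ᵥ f a = 0 := by
    simp [f, Fintype.linearCombination_apply, mulVec_sum, mulVec_smul, hb]
  have h1 : diagonal hM.eigenvalues *ᵥ (Pᵀ *ᵥ f a) = 0 := by
    have h2 : Pᵀ *ᵥ (M *ᵥ f a) = 0 := by rw [h0, mulVec_zero]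
    rw [congrArg (fun N => N *ᵥ f a) hP] at h2
    rw [mulVec_mulVec, ← Matrix.mul_assoc, ← Matrix.mul_assoc, hPP', Matrix.one_mul] at h2
    rwa [mulVec_mulVec]
  have h3 : Pᵀ *ᵥ f a = 0 := by
    ext i
    by_cases hi : hM.eigenvalues i = 0
    · exact congrFun ha ⟨i, hi⟩
    · have := congrFun h1 i
      rw [mulVec_diagonal] at this
      exact (mul_eq_zero.mp this).resolve_left hi
  have h4 : f a = 0 := by
    have : P *ᵥ (Pᵀ *ᵥ f a) = 0 := by rw [h3, mulVec_zero]
    rwa [mulVec_mulVec, hPP, one_mulVec] at this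
  exact ha0 (funext (Fintype.linearIndependent_iff.mp hli a
    (by simpa [f, Fintype.linearCombination_apply] using h4)))

theorem isHermitian_of_isSymm {M : Matrix V V ℝ} (hM : M.IsSymm) : M.IsHermitian := by
  rw [IsHermitian, conjTranspose_eq_transpose_of_trivial, hM.eq]

theorem quadForm_comm {M : Matrix V V ℝ} (hM : M.IsSymm) (x y : V → ℝ) :
    x ⬝ᵥ M *ᵥ y = y ⬝ᵥ M *ᵥ x := by
  rw [dotProduct_mulVec, ← mulVec_transpose, hM.eq, dotProduct_comm]

section HyperbolicPair

variable {M : Matrix V V ℝ} {ι : Type*} [Fintype ι] {x u : V → ℝ} {κ : ℝ}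

/-- A family of vectors of coordinate sum zero, made orthogonal to `u` by means of `x`, together
with `u + s • x`. -/
noncomputable def hyperbolicExtension (M : Matrix V V ℝ) (b : ι → V → ℝ) (x u : V → ℝ)
    (κ s : ℝ) : ι ⊕ Unit → V → ℝ :=
  Sum.elim (fun i => b i + ((u ⬝ᵥ M *ᵥ b i) / κ) • x) fun _ => u + s • x

/-- Since `M x` is constant, `x` is orthogonal to every vector of coordinate sum zero, itself
included; adding multiples of `x` to the `b i` leaves their Gram matrix unchanged. As `u` pairs with
`x` to `-κ`, the chosen multiple makes them orthogonal to `u` too. The last vector has value `-2sκ`,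
so `s` selects its sign. -/
theorem sum_hyperbolicExtension (hM : M.IsSymm) (hκ : κ ≠ 0) (hx : M *ᵥ x = fun _ => -κ)
    (hx0 : ∑ j, x j = 0) (hu : ∑ j, u j = 1) (huu : u ⬝ᵥ M *ᵥ u = 0) (b : ι → V → ℝ)
    (hb : ∀ i, ∑ j, b i j = 0) (s : ℝ) (a : ι ⊕ Unit → ℝ) :
    ∑ i, ∑ j, a i * a j * (hyperbolicExtension M b x u κ s i ⬝ᵥ
      M *ᵥ hyperbolicExtension M b x u κ s j) =
      (∑ i, ∑ j, a (.inl i) * a (.inl j) * (b i ⬝ᵥ M *ᵥ b j))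
        - 2 * s * κ * a (.inr ()) ^ 2 := by
  have hyx (y : V → ℝ) : y ⬝ᵥ M *ᵥ x = -κ * ∑ j, y j := by
    rw [hx, dotProduct, ← Finset.sum_mul, mul_comm]
  have hxy (y : V → ℝ) : x ⬝ᵥ M *ᵥ y = -κ * ∑ j, y j := by rw [quadForm_comm hM, hyx]
  have h1 (i j : ι) : hyperbolicExtension M b x u κ s (.inl i) ⬝ᵥ
      M *ᵥ hyperbolicExtension M b x u κ s (.inl j) = b i ⬝ᵥ M *ᵥ b j := by
    simp [hyperbolicExtension, mulVec_add, mulVec_smul, hyx, hxy, hx0, hb, Finset.sum_add_distrib,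
      ← Finset.mul_sum]
  have h2 (i : ι) : hyperbolicExtension M b x u κ s (.inr ()) ⬝ᵥ
      M *ᵥ hyperbolicExtension M b x u κ s (.inl i) = 0 := by
    simp [hyperbolicExtension, mulVec_add, mulVec_smul, hyx, hxy, hx0, hb, hu, Finset.sum_add_distrib,
      ← Finset.mul_sum]
    field_simp
    simp
  have h3 : hyperbolicExtension M b x u κ s (.inr ()) ⬝ᵥ
      M *ᵥ hyperbolicExtension M b x u κ s (.inr ()) = -2 * s * κ := by
    simp [hyperbolicExtension, mulVec_add, mulVec_smul, hyx, hxy, hx0, hu, huu, Finset.sum_add_distrib,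
      ← Finset.mul_sum]
    ring
  simp only [Fintype.sum_sum_type, h1, h2, h3, quadForm_comm hM
    (hyperbolicExtension M b x u κ s (.inl _)) (hyperbolicExtension M b x u κ s (.inr _)),
    Finset.univ_unique, Finset.sum_singleton, PUnit.default_eq_unit, mul_zero, add_zero,
    Finset.sum_const_zero, zero_add]
  ring

theorem card_add_one_le_negInertia (hM : M.IsSymm) (hκ : 0 < κ) (hx : M *ᵥ x = fun _ => -κ)
    (hx0 : ∑ j, x j = 0) (hu : ∑ j, u j = 1) (huu : u ⬝ᵥ M *ᵥ u = 0) (b : ι → V → ℝ)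
    (hb : ∀ i, ∑ j, b i j = 0)
    (hneg : ∀ a : ι → ℝ, a ≠ 0 → ∑ i, ∑ j, a i * a j * (b i ⬝ᵥ M *ᵥ b j) < 0) :
    Fintype.card ι + 1 ≤ negInertia M := by
  have := card_le_negInertia (M := M) (isHermitian_of_isSymm hM)
    (hyperbolicExtension M b x u κ 1) fun a ha => by
      rw [sum_hyperbolicExtension hM hκ.ne' hx hx0 hu huu b hb]
      by_cases h : (fun i => a (.inl i)) = 0
      · have h' : a (.inr ()) ≠ 0 := fun h' => ha (by
          ext (i | i)
          · exact congrFun h i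
          · exact h')
        have h'' (i) : a (.inl i) = 0 := congrFun h i
        simp only [h'', zero_mul, Finset.sum_const_zero]
        have := mul_pos hκ (pow_pos (abs_pos.mpr h') 2)
        rw [sq_abs] at this
        linarith
      · have := hneg _ h
        have := mul_nonneg hκ.le (sq_nonneg (a (.inr ())))
        linarith
  simpa using this

theorem card_add_one_le_posInertia (hM : M.IsSymm) (hκ : 0 < κ) (hx : M *ᵥ x = fun _ => -κ)
    (hx0 : ∑ j, x j = 0) (hu : ∑ j, u j = 1) (huu : u ⬝ᵥ M *ᵥ u = 0) (b : ι → V → ℝ)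
    (hb : ∀ i, ∑ j, b i j = 0)
    (hpos : ∀ a : ι → ℝ, a ≠ 0 → 0 < ∑ i, ∑ j, a i * a j * (b i ⬝ᵥ M *ᵥ b j)) :
    Fintype.card ι + 1 ≤ posInertia M := by
  have := card_le_posInertia (M := M) (isHermitian_of_isSymm hM)
    (hyperbolicExtension M b x u κ (-1)) fun a ha => by
      rw [sum_hyperbolicExtension hM hκ.ne' hx hx0 hu huu b hb]
      by_cases h : (fun i => a (.inl i)) = 0
      · have h' : a (.inr ()) ≠ 0 := fun h' => ha (by
          ext (i | i)
          · exact congrFun h i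
          · exact h')
        have h'' (i) : a (.inl i) = 0 := congrFun h i
        simp only [h'', zero_mul, Finset.sum_const_zero]
        have := mul_pos hκ (pow_pos (abs_pos.mpr h') 2)
        rw [sq_abs] at this
        linarith
      · have := hpos _ h
        have := mul_nonneg hκ.le (sq_nonneg (a (.inr ())))
        linarith
  simpa using this

end HyperbolicPair

end Inertia

theorem distSqMatrix_isSymm {V : Type*} (G : SimpleGraph V) : (distSqMatrix G).IsSymm := by
  ext i j
  simp [distSqMatrix, SimpleGraph.dist_comm]

/-- Evaluates the Gram matrices `cJ + dI` that occur throughout. -/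
theorem sum_delta_form {ι : Type*} [Fintype ι] [DecidableEq ι] (a : ι → ℝ) (c d : ℝ) :
    ∑ i, ∑ j, a i * a j * (c + if i = j then d else 0) = c * (∑ i, a i) ^ 2 + d * ∑ i, a i ^ 2 := by
  simp only [mul_add, Finset.sum_add_distrib, mul_ite, mul_zero, Finset.sum_ite_eq,
    Finset.mem_univ, if_true]
  rw [sq, Finset.sum_mul_sum]
  simp only [Finset.mul_sum]
  congr 1
  · exact Finset.sum_congr rfl fun i _ => Finset.sum_congr rfl fun j _ => by ring
  · exact Finset.sum_congr rfl fun i _ => by ring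

theorem sum_sq_pos_of_ne_zero {ι : Type*} [Fintype ι] {a : ι → ℝ} (ha : a ≠ 0) :
    0 < ∑ i, a i ^ 2 := by
  obtain ⟨i, hi⟩ := Function.ne_iff.mp ha
  exact Finset.sum_pos' (fun i _ => sq_nonneg _) ⟨i, Finset.mem_univ _, by positivity [show a i ≠ 0 from hi]⟩

theorem sq_sum_lt_mul_sum_sq {ι : Type*} [Fintype ι] {a : ι → ℝ} (ha : a ≠ 0) {c : ℝ}
    (hc : (Fintype.card ι : ℝ) < c) : (∑ i, a i) ^ 2 < c * ∑ i, a i ^ 2 := by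
  have h1 := sq_sum_le_card_mul_sum_sq (s := Finset.univ) (f := a)
  have h2 := mul_lt_mul_of_pos_right hc (sum_sq_pos_of_ne_zero ha)
  rw [Finset.card_univ] at h1
  linarith

/-! ### Distances in graphs and cycles -/

theorem SimpleGraph.Connected.le_add_dist {V : Type*} {G : SimpleGraph V} (hG : G.Connected)
    {φ : V → ℕ} (hφ : ∀ x y, G.Adj x y → φ y ≤ φ x + 1) (x y : V) : φ y ≤ φ x + G.dist x y := by
  have key : ∀ {x y : V} (w : G.Walk x y), φ y ≤ φ x + w.length := by
    intro x y w
    induction w with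
    | nil => simp
    | cons h w ih =>
      have := hφ _ _ h
      rw [SimpleGraph.Walk.length_cons]
      omega
  obtain ⟨w, hw⟩ := hG.exists_walk_length_eq_dist x y
  exact hw ▸ key w

theorem SimpleGraph.Connected.dist_le_dist_add_one {V : Type*} {G : SimpleGraph V}
    (hG : G.Connected) {x y : V} (h : G.Adj x y) (z : V) : G.dist z y ≤ G.dist z x + 1 := by
  have := hG.dist_triangle (u := z) (v := x) (w := y)
  rwa [SimpleGraph.dist_eq_one_iff_adj.mpr h] at this

theorem SimpleGraph.Connected.dist_seq_le {V : Type*} {G : SimpleGraph V} (hG : G.Connected)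
    {γ : ℕ → V} (hγ : ∀ k, G.Adj (γ k) (γ (k + 1))) (a k : ℕ) : G.dist (γ a) (γ (a + k)) ≤ k := by
  induction k with
  | zero => simp
  | succ k ih => exact (hG.dist_le_dist_add_one (hγ (a + k)) (γ a)).trans (by omega)

theorem cycleGraph_adj_add_one {n : ℕ} [NeZero n] (hn : 3 ≤ n) (x : Fin n) :
    (SimpleGraph.cycleGraph n).Adj x (x + 1) := by
  rw [SimpleGraph.cycleGraph_adj']
  right
  rw [add_sub_cancel_left, Fin.val_one', Nat.mod_eq_of_lt (by omega)]

theorem cycleGraph_adj_iff {n : ℕ} [NeZero n] (hn : 3 ≤ n) {x y : Fin n} :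
    (SimpleGraph.cycleGraph n).Adj x y ↔ x = y + 1 ∨ y = x + 1 := by
  have h1 : ((1 : Fin n) : ℕ) = 1 := by rw [Fin.val_one', Nat.mod_eq_of_lt (by omega)]
  rw [SimpleGraph.cycleGraph_adj']
  refine or_congr ?_ ?_
  all_goals
    rw [← h1, ← Fin.ext_iff, sub_eq_iff_eq_add, add_comm]

theorem cycleGraph_connected_of_neZero (n : ℕ) [NeZero n] :
    (SimpleGraph.cycleGraph n).Connected := by
  obtain ⟨m, rfl⟩ := Nat.exists_eq_succ_of_ne_zero (NeZero.ne n)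
  exact SimpleGraph.cycleGraph_connected

section CycleDistances

open scoped Fin.CommRing

theorem cycleGraph_dist_le {n : ℕ} [NeZero n] (hn : 3 ≤ n) (x : Fin n) (k : ℕ) :
    (SimpleGraph.cycleGraph n).dist x (x + (k : Fin n)) ≤ k := by
  have := (cycleGraph_connected_of_neZero n).dist_seq_le (γ := fun k : ℕ => x + (k : Fin n))
    (fun k => by
      rw [Nat.cast_succ, ← add_assoc]
      exact cycleGraph_adj_add_one hn _) 0 k
  simpa using this

theorem Fin.val_add_one_eq_ite {n : ℕ} [NeZero n] (hn : 3 ≤ n) (z : Fin n) :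
    ((z + 1 : Fin n) : ℕ) = if (z : ℕ) + 1 = n then 0 else (z : ℕ) + 1 := by
  rw [Fin.val_add, Fin.val_one', Nat.mod_eq_of_lt (show 1 < n by omega)]
  split_ifs with h
  · rw [h, Nat.mod_self]
  · exact Nat.mod_eq_of_lt (by omega)

theorem cycleGraph_dist {n : ℕ} [NeZero n] (hn : 3 ≤ n) (x y : Fin n) :
    (SimpleGraph.cycleGraph n).dist x y = min (y - x : Fin n).val (n - (y - x : Fin n).val) := by
  have hG := cycleGraph_connected_of_neZero n
  apply le_antisymm
  · refine le_min ?_ ?_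
    · have := cycleGraph_dist_le hn x (y - x : Fin n).val
      rwa [Fin.cast_val_eq_self, add_sub_cancel] at this
    · have := cycleGraph_dist_le hn y (n - (y - x : Fin n).val)
      rwa [Nat.cast_sub (Fin.is_lt _).le, Fin.cast_val_eq_self, Fin.natCast_self, zero_sub,
        neg_sub, add_sub_cancel, SimpleGraph.dist_comm] at this
  -- The claimed value, as a function of the endpoint, vanishes at `x` and grows by at most one
  -- along an edge.
  · have := hG.le_add_dist
      (φ := fun y => min (y - x : Fin n).val (n - (y - x : Fin n).val)) (fun a b hab => by
        have h1 := (a - x).is_lt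
        have h2 := (b - x).is_lt
        rcases (cycleGraph_adj_iff hn).mp hab with h | h
        · have h3 := Fin.val_add_one_eq_ite hn (b - x)
          rw [show b - x + 1 = a - x by rw [h]; abel] at h3
          split_ifs at h3 <;> omega
        · have h3 := Fin.val_add_one_eq_ite hn (a - x)
          rw [show a - x + 1 = b - x by rw [h]; abel] at h3
          split_ifs at h3 <;> omega) x y
    simpa using this

theorem cycleGraph_dist_add_natCast {n : ℕ} [NeZero n] (hn : 3 ≤ n) (x : Fin n) {a b : ℕ}
    (hab : a ≤ b) (hb : b ≤ n) :
    (SimpleGraph.cycleGraph n).dist (x + (a : Fin n)) (x + (b : Fin n)) =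
      min (b - a) (n - (b - a)) := by
  rw [cycleGraph_dist hn, add_sub_add_left_eq_sub, ← Nat.cast_sub hab, Fin.val_natCast]
  rcases eq_or_ne (b - a) n with h | h
  · rw [h]; simp
  · rw [Nat.mod_eq_of_lt (by omega)]

end CycleDistances

/-! ### Edge vectors of an isometric even cycle -/

section Flows

open Matrix

variable {V : Type*} [Fintype V] [DecidableEq V]

/-- The difference of the indicators of the ends of the edge from `γ k` to `γ (k + 1)`. -/
noncomputable def edgeDiff (γ : ℕ → V) (k : ℕ) : V → ℝ :=
  Pi.single (γ (k + 1)) 1 - Pi.single (γ k) 1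

/-- Difference of the vectors of two antipodal edges of a cycle of length `2 * m`. -/
noncomputable def oddFlow (γ : ℕ → V) (m k : ℕ) : V → ℝ := edgeDiff γ k - edgeDiff γ (k + m)

/-- Sum of the vectors of two antipodal edges of a cycle of length `2 * m`. -/
noncomputable def evenFlow (γ : ℕ → V) (m k : ℕ) : V → ℝ := edgeDiff γ k + edgeDiff γ (k + m)

theorem edgeDiff_dotProduct (γ : ℕ → V) (k : ℕ) (x : V → ℝ) :
    edgeDiff γ k ⬝ᵥ x = x (γ (k + 1)) - x (γ k) := by
  simp [edgeDiff, sub_dotProduct]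

/-- `γ` runs once around an isometric cycle of length `2 * m`. -/
def IsIsometricCycle (G : SimpleGraph V) (m : ℕ) (γ : ℕ → V) : Prop :=
  ∀ a b : ℕ, a ≤ b → b ≤ 2 * m → G.dist (γ a) (γ b) = min (b - a) (2 * m - (b - a))

variable {G : SimpleGraph V} {m : ℕ} {γ : ℕ → V}

/-- The entry is a mixed second difference of squared distance: `2n² - (n-1)² - (n+1)² = -2` on
either monotone arc, and `2m² - 2(m-1)² = 4m - 2` at the antipode, where the distance turns around.
-/
theorem edgeDiff_gram_of_le (hγ : IsIsometricCycle G m γ) (hm : 2 ≤ m) {k l : ℕ} (hkl : k ≤ l)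
    (hl : l < 2 * m) :
    edgeDiff γ k ⬝ᵥ distSqMatrix G *ᵥ edgeDiff γ l = -2 + if l = k + m then 4 * (m : ℝ) else 0 := by
  have h : edgeDiff γ k ⬝ᵥ distSqMatrix G *ᵥ edgeDiff γ l =
      (G.dist (γ (k + 1)) (γ (l + 1)) : ℝ) ^ 2 - (G.dist (γ (k + 1)) (γ l) : ℝ) ^ 2
        - ((G.dist (γ k) (γ (l + 1)) : ℝ) ^ 2 - (G.dist (γ k) (γ l) : ℝ) ^ 2) := by
    rw [edgeDiff_dotProduct, edgeDiff, mulVec_sub]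
    simp [distSqMatrix]
  rw [h, hγ _ _ (by omega) (by omega), hγ k (l + 1) (by omega) (by omega), hγ k l hkl (by omega)]
  obtain ⟨n, rfl⟩ := Nat.exists_eq_add_of_le hkl
  rcases n with _ | n
  · have h1 : G.dist (γ (k + 1)) (γ (k + 0)) = 1 := by
      rw [SimpleGraph.dist_comm, hγ _ _ (by omega) (by omega)]; omega
    rw [h1, if_neg (by omega), show min (k + 0 + 1 - k) (2 * m - (k + 0 + 1 - k)) = 1 by omega]
    simp
    norm_num
  · rw [hγ _ _ (by omega) (by omega)]
    rcases lt_trichotomy (n + 1) m with h | h | h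
    · rw [if_neg (by omega),
        show min (k + (n + 1) + 1 - (k + 1)) (2 * m - (k + (n + 1) + 1 - (k + 1))) = n + 1 by omega,
        show min (k + (n + 1) - (k + 1)) (2 * m - (k + (n + 1) - (k + 1))) = n by omega,
        show min (k + (n + 1) + 1 - k) (2 * m - (k + (n + 1) + 1 - k)) = n + 2 by omega,
        show min (k + (n + 1) - k) (2 * m - (k + (n + 1) - k)) = n + 1 by omega]
      push_cast; ring
    · rw [if_pos (by omega),
        show min (k + (n + 1) + 1 - (k + 1)) (2 * m - (k + (n + 1) + 1 - (k + 1))) = m by omega,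
        show min (k + (n + 1) - (k + 1)) (2 * m - (k + (n + 1) - (k + 1))) = n by omega,
        show min (k + (n + 1) + 1 - k) (2 * m - (k + (n + 1) + 1 - k)) = n by omega,
        show min (k + (n + 1) - k) (2 * m - (k + (n + 1) - k)) = m by omega, ← h]
      push_cast; ring
    -- Past the antipode, `s + 1` is the length of the shorter arc.
    · obtain ⟨s, hs⟩ := Nat.exists_eq_add_of_lt (show n + 1 < 2 * m by omega)
      rw [if_neg (by omega),
        show min (k + (n + 1) + 1 - (k + 1)) (2 * m - (k + (n + 1) + 1 - (k + 1))) = s + 1 by omega,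
        show min (k + (n + 1) - (k + 1)) (2 * m - (k + (n + 1) - (k + 1))) = s + 2 by omega,
        show min (k + (n + 1) + 1 - k) (2 * m - (k + (n + 1) + 1 - k)) = s by omega,
        show min (k + (n + 1) - k) (2 * m - (k + (n + 1) - k)) = s + 1 by omega]
      push_cast; ring

theorem edgeDiff_gram (hγ : IsIsometricCycle G m γ) (hm : 2 ≤ m) {k l : ℕ} (hk : k < 2 * m)
    (hl : l < 2 * m) :
    edgeDiff γ k ⬝ᵥ distSqMatrix G *ᵥ edgeDiff γ l =
      -2 + if l = k + m ∨ k = l + m then 4 * (m : ℝ) else 0 := by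
  rcases le_total k l with h | h
  · rw [edgeDiff_gram_of_le hγ hm h hl]
    simp [show k ≠ l + m by omega]
  · rw [quadForm_comm (distSqMatrix_isSymm G), edgeDiff_gram_of_le hγ hm h hk]
    simp [show l ≠ k + m by omega]

theorem oddFlow_gram (hγ : IsIsometricCycle G m γ) (hm : 2 ≤ m) {k l : ℕ} (hk : k < m)
    (hl : l < m) :
    oddFlow γ m k ⬝ᵥ distSqMatrix G *ᵥ oddFlow γ m l = if k = l then -(8 * (m : ℝ)) else 0 := by
  rw [oddFlow, oddFlow, mulVec_sub, sub_dotProduct, dotProduct_sub, dotProduct_sub,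
    edgeDiff_gram hγ hm (by omega) (by omega), edgeDiff_gram hγ hm (by omega) (by omega),
    edgeDiff_gram hγ hm (by omega) (by omega), edgeDiff_gram hγ hm (by omega) (by omega)]
  rw [if_neg (by omega), if_neg (by omega : ¬ (l + m = k + m + m ∨ k + m = l + m + m))]
  by_cases h : k = l
  · subst h; simp; ring
  · rw [if_neg (by omega), if_neg (by omega), if_neg h]; ring

/-- The matrix `8mI - 8J` of all `m` even flows is singular, so only `m - 1` of them are used as
positive directions. -/
theorem evenFlow_gram (hγ : IsIsometricCycle G m γ) (hm : 2 ≤ m) {k l : ℕ} (hk : k < m)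
    (hl : l < m) :
    evenFlow γ m k ⬝ᵥ distSqMatrix G *ᵥ evenFlow γ m l =
      -8 + if k = l then 8 * (m : ℝ) else 0 := by
  rw [evenFlow, evenFlow, mulVec_add, add_dotProduct, dotProduct_add, dotProduct_add,
    edgeDiff_gram hγ hm (by omega) (by omega), edgeDiff_gram hγ hm (by omega) (by omega),
    edgeDiff_gram hγ hm (by omega) (by omega), edgeDiff_gram hγ hm (by omega) (by omega)]
  rw [if_neg (by omega), if_neg (by omega : ¬ (l + m = k + m + m ∨ k + m = l + m + m))]
  by_cases h : k = l
  · subst h; simp; ring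
  · rw [if_neg (by omega), if_neg (by omega), if_neg h]; ring

theorem sum_edgeDiff (γ : ℕ → V) (k : ℕ) : ∑ j, edgeDiff γ k j = 0 := by
  simp [edgeDiff]

theorem sum_oddFlow (γ : ℕ → V) (m k : ℕ) : ∑ j, oddFlow γ m k j = 0 := by
  simp [oddFlow, sum_edgeDiff]

theorem sum_evenFlow (γ : ℕ → V) (m k : ℕ) : ∑ j, evenFlow γ m k j = 0 := by
  simp [evenFlow, sum_edgeDiff, Finset.sum_add_distrib]

theorem oddFlow_dotProduct (γ : ℕ → V) (m k : ℕ) (x : V → ℝ) :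
    oddFlow γ m k ⬝ᵥ x = x (γ (k + 1)) - x (γ k) - (x (γ (k + m + 1)) - x (γ (k + m))) := by
  rw [oddFlow, sub_dotProduct, edgeDiff_dotProduct, edgeDiff_dotProduct]

theorem evenFlow_dotProduct (γ : ℕ → V) (m k : ℕ) (x : V → ℝ) :
    evenFlow γ m k ⬝ᵥ x = x (γ (k + 1)) - x (γ k) + (x (γ (k + m + 1)) - x (γ (k + m))) := by
  rw [evenFlow, add_dotProduct, edgeDiff_dotProduct, edgeDiff_dotProduct]

end Flows

/-! ### Inertia of the even cycle -/

section Cycle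

open Matrix
open scoped Fin.CommRing

theorem isIsometricCycle_cycleGraph {m : ℕ} [NeZero (2 * m)] (hm : 2 ≤ m) :
    IsIsometricCycle (SimpleGraph.cycleGraph (2 * m)) m (fun k => (k : Fin (2 * m))) := by
  intro a b hab hb
  simpa using cycleGraph_dist_add_natCast (show 3 ≤ 2 * m by omega) 0 hab hb

theorem distSqMatrix_cycleGraph_mulVec_one {n : ℕ} [NeZero n] (hn : 3 ≤ n) :
    ∃ c : ℝ, 0 < c ∧
      distSqMatrix (SimpleGraph.cycleGraph n) *ᵥ (fun _ => 1) = fun _ => c := by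
  refine ⟨∑ z : Fin n, ((min z.val (n - z.val) : ℕ) : ℝ) ^ 2, ?_, ?_⟩
  · refine Finset.sum_pos' (fun i _ => sq_nonneg _) ⟨⟨1, by omega⟩, Finset.mem_univ _, ?_⟩
    have : 0 < min 1 (n - 1) := by omega
    positivity
  · ext x
    simp only [mulVec, dotProduct, distSqMatrix, of_apply, mul_one, cycleGraph_dist hn]
    exact (Equiv.subRight x).sum_comp fun z : Fin n => ((min z.val (n - z.val) : ℕ) : ℝ) ^ 2

/-- The `m` odd flows span a negative definite space; `m - 1` even flows and the all-ones vector,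
orthogonal to them because row sums are constant, span a positive definite one. Together they
exhaust dimension `2m`. -/
theorem negInertia_distSqMatrix_cycleGraph {m : ℕ} (hm : 2 ≤ m) :
    negInertia (distSqMatrix (SimpleGraph.cycleGraph (2 * m))) = m := by
  have : NeZero (2 * m) := ⟨by omega⟩
  set M := distSqMatrix (SimpleGraph.cycleGraph (2 * m)) with hM
  have hsymm : M.IsSymm := distSqMatrix_isSymm _
  have hγ := isIsometricCycle_cycleGraph hm
  set γ : ℕ → Fin (2 * m) := fun k => (k : Fin (2 * m))
  have hm' : (0 : ℝ) < m := by positivity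
  have h1 : m ≤ negInertia M := by
    have := card_le_negInertia (isHermitian_of_isSymm hsymm) (fun k : Fin m => oddFlow γ m k)
      fun a ha => by
        have (i j : Fin m) : a i * a j * (oddFlow γ m i ⬝ᵥ M *ᵥ oddFlow γ m j) =
            a i * a j * (0 + if i = j then -(8 * (m : ℝ)) else 0) := by
          rw [oddFlow_gram hγ hm i.2 j.2, zero_add]
          simp [Fin.ext_iff]
        simp only [this]
        rw [sum_delta_form]
        have := mul_pos hm' (sum_sq_pos_of_ne_zero ha)
        linarith
    simpa using this
  have h2 : m ≤ posInertia M := by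
    obtain ⟨c, hc, hc'⟩ := distSqMatrix_cycleGraph_mulVec_one (show 3 ≤ 2 * m by omega)
    rw [← hM] at hc'
    have hx1 (x : Fin (2 * m) → ℝ) : x ⬝ᵥ M *ᵥ (fun _ => 1) = (∑ j, x j) * c := by
      rw [hc', dotProduct, Finset.sum_mul]
    have h1x (x : Fin (2 * m) → ℝ) : (fun _ => 1) ⬝ᵥ M *ᵥ x = (∑ j, x j) * c := by
      rw [quadForm_comm hsymm, hx1]
    have := card_le_posInertia (isHermitian_of_isSymm hsymm)
      (Sum.elim (fun k : Fin (m - 1) => evenFlow γ m k) fun _ : Unit => fun _ => 1)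
      fun a ha => by
        have (i j : Fin (m - 1)) : evenFlow γ m i ⬝ᵥ M *ᵥ evenFlow γ m j =
            -8 + if i = j then 8 * (m : ℝ) else 0 := by
          rw [evenFlow_gram hγ hm (i.2.trans_le (by omega)) (j.2.trans_le (by omega))]
          simp [Fin.ext_iff]
        simp only [Fintype.sum_sum_type, Sum.elim_inl, Sum.elim_inr, hx1, h1x, sum_evenFlow, this,
          Finset.univ_unique, Finset.sum_singleton, PUnit.default_eq_unit, zero_mul, mul_zero,
          add_zero, zero_add, Finset.sum_const_zero]
        rw [sum_delta_form]
        have h4 : (0 : ℝ) < (∑ j : Fin (2 * m), 1) * c := by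
          simp only [Finset.sum_const, Finset.card_univ, Fintype.card_fin]
          push_cast [nsmul_eq_mul]
          positivity
        by_cases h : (fun i => a (.inl i)) = 0
        · have h' : a (.inr ()) ≠ 0 := fun h' => ha (by
            ext (i | i)
            · exact congrFun h i
            · exact h')
          have h'' (i) : a (.inl i) = 0 := congrFun h i
          simp only [h'']
          have := mul_pos (mul_self_pos.mpr h') h4
          simpa using this
        · have h5 := sq_sum_lt_mul_sum_sq h (c := m) (by
            rw [Fintype.card_fin]; exact_mod_cast (by omega : m - 1 < m))
          have := mul_nonneg (mul_self_nonneg (a (.inr ()))) h4.le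
          linarith
    simp only [Fintype.card_sum, Fintype.card_fin, Fintype.card_unit] at this
    omega
  have h3 := negInertia_add_zeroInertia_add_posInertia (isHermitian_of_isSymm hsymm)
  rw [Fintype.card_fin] at h3
  omega

end Cycle

/-! ### Gates in trees and isometric subgraphs -/

namespace SimpleGraph

variable {V : Type*} {G : SimpleGraph V}

theorem Connected.exists_adj_dist_add_one (hG : G.Connected) {i j : V} (hij : i ≠ j) :
    ∃ k, G.Adj i k ∧ G.dist k j + 1 = G.dist i j := by
  obtain ⟨w, hw⟩ := hG.exists_walk_length_eq_dist i j
  cases w with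
  | nil => exact absurd rfl hij
  | @cons _ k _ h w =>
    refine ⟨k, h, ?_⟩
    have h1 := dist_le w
    have h2 := hG.dist_le_dist_add_one h.symm j
    rw [dist_comm, dist_comm (v := k)] at h2
    rw [Walk.length_cons] at hw
    omega

theorem IsTree.eq_of_adj_of_dist_add_one (hG : G.IsTree) {i j k k' : V} (hk : G.Adj i k)
    (hk' : G.Adj i k') (hd : G.dist k j + 1 = G.dist i j) (hd' : G.dist k' j + 1 = G.dist i j) :
    k = k' := by
  obtain ⟨w, hw⟩ := hG.1.exists_walk_length_eq_dist k j
  obtain ⟨w', hw'⟩ := hG.1.exists_walk_length_eq_dist k' j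
  have h1 : (Walk.cons hk w).IsPath :=
    Walk.isPath_of_length_eq_dist _ (by rw [Walk.length_cons, hw, hd])
  have h2 : (Walk.cons hk' w').IsPath :=
    Walk.isPath_of_length_eq_dist _ (by rw [Walk.length_cons, hw', hd'])
  have h3 := (hG.existsUnique_path i j).unique h1 h2
  have h4 := congrArg Walk.snd h3
  simpa using h4

/-- The neighbours of `i` behave towards `j` as in a tree: exactly one of them is closer to `j`
than `i`, and the others are farther. -/
def HasGate (G : SimpleGraph V) (i j : V) : Prop :=
  ∃ k, G.Adj i k ∧ G.dist k j + 1 = G.dist i j ∧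
    ∀ k', G.Adj i k' → k' ≠ k → G.dist k' j = G.dist i j + 1

theorem IsTree.hasGate (hG : G.IsTree) {i j : V} (hij : i ≠ j) : G.HasGate i j := by
  obtain ⟨k, hk, hd⟩ := hG.1.exists_adj_dist_add_one hij
  refine ⟨k, hk, hd, fun k' hk' hne => ?_⟩
  have h := hG.dist_eq_dist_add_one_of_adj j hk'
  rw [dist_comm, dist_comm (u := j) (v := k')] at h
  rcases h with h | h
  · exact absurd (hG.eq_of_adj_of_dist_add_one hk' hk h.symm hd) hne
  · exact h

/-- A retraction sending each edge to an edge or a point does not increase distances, so no path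
outside `S` is a shortcut. -/
theorem dist_induce_eq_of_retraction {S : Set V} (hS : (G.induce S).Connected)
    (hG : G.Connected) (ρ : V → S) (hρ : ∀ x : S, ρ x = x)
    (hadj : ∀ x y, G.Adj x y → ρ x = ρ y ∨ (G.induce S).Adj (ρ x) (ρ y)) (x y : S) :
    G.dist x y = (G.induce S).dist x y := by
  apply le_antisymm
  · obtain ⟨w, hw⟩ := hS.exists_walk_length_eq_dist x y
    rw [← hw, ← Walk.length_map (Embedding.induce S).toHom w]
    exact dist_le _
  · have := hG.le_add_dist (φ := fun z => (G.induce S).dist x (ρ z)) (fun a b hab => by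
      rcases hadj a b hab with h | h
      · simp [h]
      · exact hS.dist_le_dist_add_one h x) x y
    simpa [hρ] using this

theorem dist_iso {W : Type*} {H : SimpleGraph W} (hG : G.Connected) (hH : H.Connected)
    (f : G ≃g H) (x y : V) : H.dist (f x) (f y) = G.dist x y := by
  apply le_antisymm
  · obtain ⟨w, hw⟩ := hG.exists_walk_length_eq_dist x y
    rw [← hw, ← Walk.length_map f.toHom w]
    exact dist_le _
  · obtain ⟨w, hw⟩ := hH.exists_walk_length_eq_dist (f x) (f y)
    have h := dist_le (w.map f.symm.toHom)
    rw [Walk.length_map, hw] at h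
    have e (z : V) : f.symm.toHom (f z) = z := f.symm_apply_apply z
    rwa [e, e] at h

end SimpleGraph

/-! ### The metric model of a cycle with a tree -/

/-- A connected graph made of the isometric cycle `γ 0, …, γ (2 * m)` and of a tree on the vertex
set `T`, joined by the edge between `γ 0` and `w`, described by its distances. -/
structure IsCycleTreeModel {V : Type*} [Fintype V] [DecidableEq V] (U : SimpleGraph V) (m : ℕ)
    (γ : ℕ → V) (T : Finset V) (w : V) : Prop where
  connected : U.Connected
  isometric : IsIsometricCycle U m γ
  notMem_iff : ∀ x, x ∉ T ↔ ∃ k < 2 * m, γ k = x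
  adj_succ : ∀ k, U.Adj (γ k) (γ (k + 1))
  period : γ (2 * m) = γ 0
  mem_root : w ∈ T
  adj_iff : ∀ x ∉ T, ∀ y ∈ T, (U.Adj x y ↔ x = γ 0 ∧ y = w)
  reachable_root : ∀ x ∉ T, ∀ y ∈ T, ∀ (hy : y ∈ ({x}ᶜ : Set V)) (hw : w ∈ ({x}ᶜ : Set V)),
    (U.induce {x}ᶜ).Reachable ⟨y, hy⟩ ⟨w, hw⟩
  dist_eq : ∀ i ∈ T, ∀ c ∉ T, U.dist i c = U.dist i w + 1 + U.dist (γ 0) c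
  hasGate : ∀ i ∈ T, ∀ j, i ≠ j → U.HasGate i j

section Model

open SimpleGraph

open scoped Fin.CommRing in
theorem IsCycleWithTree.exists_model {V : Type*} [Fintype V] [DecidableEq V] {U : SimpleGraph V}
    {m : ℕ} (hU : IsCycleWithTree U (2 * m)) :
    ∃ γ T w, IsCycleTreeModel U m γ T w := by
  classical
  obtain ⟨hp, C, ⟨f⟩, hT, v, hv, w, hw, hadj⟩ := hU
  have : NeZero (2 * m) := ⟨by omega⟩
  have hcyc := cycleGraph_connected_of_neZero (2 * m)
  have hC : (U.induce C).Connected := f.connected_iff.mp hcyc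
  have hvw : U.Adj v w := (hadj v hv w hw).mpr ⟨rfl, rfl⟩
  have hreachC (x : V) (hx : x ∈ C) : U.Reachable v x :=
    (hC.preconnected ⟨v, hv⟩ ⟨x, hx⟩).map (Embedding.induce C).toHom
  have hreachT (x : V) (hx : x ∈ Cᶜ) : U.Reachable w x :=
    (hT.1.preconnected ⟨w, hw⟩ ⟨x, hx⟩).map (Embedding.induce Cᶜ).toHom
  have hreach (x : V) : U.Reachable v x := by
    by_cases hx : x ∈ C
    · exact hreachC x hx
    · exact hvw.reachable.trans (hreachT x hx)
  have hconn : U.Connected :=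
    { preconnected := fun x y => (hreach x).symm.trans (hreach y)
      nonempty := ⟨v⟩ }
  have hdC (x y : C) : U.dist x y = (U.induce C).dist x y := by
    -- Collapse the tree to `v`; below, collapse the cycle to `w`.
    refine dist_induce_eq_of_retraction hC hconn (fun z => if hz : z ∈ C then ⟨z, hz⟩ else ⟨v, hv⟩)
      (by simp) (fun a b hab => ?_) x y
    by_cases ha : a ∈ C <;> by_cases hb : b ∈ C
    · right; simpa [ha, hb] using hab
    · left; simp [hb, ((hadj a ha b hb).mp hab).1]
    · left; simp [ha, ((hadj b hb a ha).mp hab.symm).1]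
    · left; simp [ha, hb]
  have hdT (x y : (Cᶜ : Set V)) : U.dist x y = (U.induce Cᶜ).dist x y := by
    refine dist_induce_eq_of_retraction hT.1 hconn
      (fun z => if hz : z ∈ C then ⟨w, hw⟩ else ⟨z, hz⟩) (fun x => by
        have : (x : V) ∉ C := x.2
        simp [this]) (fun a b hab => ?_) x y
    by_cases ha : a ∈ C <;> by_cases hb : b ∈ C
    · left; simp [ha, hb]
    · left; simp [ha, ((hadj a ha b hb).mp hab).2]
    · left; simp [hb, ((hadj b hb a ha).mp hab.symm).2]
    · right; simpa [ha, hb] using hab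
  have hmix (i : V) (hi : i ∉ C) (c : V) (hc : c ∈ C) :
      U.dist i c = U.dist i w + 1 + U.dist v c := by
    apply le_antisymm
    · have h1 := hconn.dist_triangle (u := i) (v := w) (w := c)
      have h2 := hconn.dist_triangle (u := w) (v := v) (w := c)
      rw [dist_eq_one_iff_adj.mpr hvw.symm] at h2
      omega
    -- The potential is the distance from `c` on the cycle, continued across the bridge `v w` by the
    -- distance from `w`.
    · have := hconn.le_add_dist
        (φ := fun z => if z ∈ C then U.dist c z else U.dist c v + 1 + U.dist w z)
        (fun a b hab => by
          by_cases ha : a ∈ C <;> by_cases hb : b ∈ C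
          · simpa [ha, hb] using hconn.dist_le_dist_add_one hab c
          · obtain ⟨rfl, rfl⟩ := (hadj a ha b hb).mp hab
            simp [ha, hb]
          · obtain ⟨rfl, rfl⟩ := (hadj b hb a ha).mp hab.symm
            simp [ha, hb]; omega
          · have := hconn.dist_le_dist_add_one hab w
            simp [ha, hb]; omega) c i
      simp only [hc, hi, if_true, if_false, dist_self, zero_add] at this
      rw [dist_comm (u := i) (v := c), dist_comm (u := i), dist_comm (u := v)]
      omega
  set v0 := f.symm ⟨v, hv⟩ with hv0
  let γ : ℕ → V := fun k => (f (v0 + (k : Fin (2 * m))) : V)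
  have hγ0 : γ 0 = v := by simp [γ, hv0]
  have hγC (k : ℕ) : γ k ∈ C := (f (v0 + (k : Fin (2 * m)))).2
  have hT_nbr (i : V) (hi : i ∉ C) (k : V) (hik : U.Adj i k) : k ∉ C ∨ (k = v ∧ i = w) := by
    by_cases hk : k ∈ C
    · exact Or.inr ((hadj k hk i hi).mp hik.symm)
    · exact Or.inl hk
  refine ⟨γ, Finset.univ.filter (· ∉ C), w, ⟨hconn, ?_, ?_, ?_, ?_, by simpa using hw, ?_, ?_,
    ?_, ?_⟩⟩
  · intro a b hab hb
    rw [← cycleGraph_dist_add_natCast hp v0 hab hb, ← dist_iso hcyc hC f, ← hdC]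
  · intro x
    simp only [Finset.mem_filter, Finset.mem_univ, true_and, not_not]
    constructor
    · intro hx
      refine ⟨(f.symm ⟨x, hx⟩ - v0 : Fin (2 * m)).val, Fin.is_lt _, ?_⟩
      simp [γ, Fin.cast_val_eq_self]
    · rintro ⟨k, -, rfl⟩
      exact hγC k
  · intro k
    have h : (U.induce C).Adj (f (v0 + (k : Fin (2 * m)))) (f (v0 + ((k + 1 : ℕ) : Fin (2 * m)))) := by
      rw [f.map_adj_iff, Nat.cast_succ, ← add_assoc]
      exact cycleGraph_adj_add_one hp _
    exact h
  · simp [γ]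
  · intro x hx y hy
    simp only [Finset.mem_filter, Finset.mem_univ, true_and, not_not] at hx hy
    rw [hγ0]
    exact hadj x hx y hy
  · intro x hx y hy _ _
    simp only [Finset.mem_filter, Finset.mem_univ, true_and, not_not] at hx hy
    have hsub : Cᶜ ⊆ ({x}ᶜ : Set V) := fun z hz hzx => hz (hzx ▸ hx)
    exact (hT.1.preconnected ⟨y, hy⟩ ⟨w, hw⟩).map (induceHomOfLE U hsub).toHom
  · intro i hi c hc
    simp only [Finset.mem_filter, Finset.mem_univ, true_and, not_not] at hi hc
    rw [hγ0]
    exact hmix i hi c hc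
  · intro i hi j hij
    simp only [Finset.mem_filter, Finset.mem_univ, true_and] at hi
    by_cases hj : j ∈ C
    · by_cases hiw : i = w
      · subst hiw
        refine ⟨v, hvw.symm, ?_, fun k hk hkv => ?_⟩
        · rw [hmix i hi j hj, dist_self]; omega
        · have hkC := (hT_nbr i hi k hk).resolve_right fun h => hkv h.1
          rw [hmix i hi j hj, hmix k hkC j hj, dist_self, dist_eq_one_iff_adj.mpr hk.symm]
          omega
      · obtain ⟨⟨k, hkC⟩, hk, hd, hall⟩ := hT.hasGate (i := ⟨i, hi⟩) (j := ⟨w, hw⟩)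
          (fun h => hiw (congrArg Subtype.val h))
        rw [← hdT, ← hdT] at hd
        refine ⟨k, hk, ?_, fun k' hk' hne => ?_⟩
        · rw [hmix i hi j hj, hmix k hkC j hj]
          simp only at hd
          omega
        · have hkC' := (hT_nbr i hi k' hk').resolve_right fun h => hiw h.2
          have := hall ⟨k', hkC'⟩ hk' (fun h => hne (congrArg Subtype.val h))
          rw [← hdT, ← hdT] at this
          rw [hmix i hi j hj, hmix k' hkC' j hj, this]
          simp only
          omega
    · obtain ⟨⟨k, hkC⟩, hk, hd, hall⟩ := hT.hasGate (i := ⟨i, hi⟩) (j := ⟨j, hj⟩)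
          (fun h => hij (congrArg Subtype.val h))
      rw [← hdT, ← hdT] at hd
      refine ⟨k, hk, hd, fun k' hk' hne => ?_⟩
      rcases hT_nbr i hi k' hk' with hkC' | ⟨rfl, rfl⟩
      · have := hall ⟨k', hkC'⟩ hk' (fun h => hne (congrArg Subtype.val h))
        rwa [← hdT, ← hdT] at this
      · rw [dist_comm, hmix j hj k' hv, dist_self, dist_comm]

end Model

/-! ### Laplacian rows at vertices with gates -/

section LaplacianRows

open Matrix SimpleGraph

variable {V : Type*} [Fintype V] [DecidableEq V] {U : SimpleGraph V} [DecidableRel U.Adj]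

set_option linter.unusedSectionVars false

/-- A row of the Laplacian matrix. -/
noncomputable def lapRow (U : SimpleGraph V) [DecidableRel U.Adj] (i : V) : V → ℝ :=
  fun j => U.lapMatrix ℝ i j

theorem lapRow_dotProduct (i : V) (x : V → ℝ) :
    lapRow U i ⬝ᵥ x = U.degree i * x i - ∑ k ∈ U.neighborFinset i, x k :=
  lapMatrix_mulVec_apply U i x

theorem sum_lapRow (i : V) : ∑ j, lapRow U i j = 0 := by
  have := congrFun (lapMatrix_mulVec_const_eq_zero (R := ℝ) U) i
  simpa [mulVec, dotProduct, lapRow] using this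

theorem SimpleGraph.HasGate.sum_neighbors {i j : V} (h : U.HasGate i j) (f : ℕ → ℝ) :
    ∃ d : ℕ, U.dist i j = d + 1 ∧
      ∑ k ∈ U.neighborFinset i, f (U.dist k j) = f d + (U.degree i - 1) * f (d + 2) := by
  obtain ⟨k, hk, hd, hall⟩ := h
  refine ⟨U.dist k j, hd.symm, ?_⟩
  have hmem : k ∈ U.neighborFinset i := by simpa using hk
  have hcongr (k' : V) (hk' : k' ∈ (U.neighborFinset i).erase k) :
      f (U.dist k' j) = f (U.dist k j + 2) := by
    rw [Finset.mem_erase, mem_neighborFinset] at hk'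
    rw [hall k' hk'.2 hk'.1, ← hd]
  rw [← Finset.add_sum_erase _ _ hmem, Finset.sum_congr rfl hcongr, Finset.sum_const,
    Finset.card_erase_of_mem hmem, card_neighborFinset_eq_degree, nsmul_eq_mul, Nat.cast_sub,
    Nat.cast_one]
  rw [← card_neighborFinset_eq_degree]
  exact Finset.card_pos.mpr ⟨k, hmem⟩

theorem sum_neighbors_self (i : V) (f : ℕ → ℝ) :
    ∑ k ∈ U.neighborFinset i, f (U.dist k i) = U.degree i * f 1 := by
  have hcongr (k : V) (hk : k ∈ U.neighborFinset i) : f (U.dist k i) = f 1 := by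
    rw [mem_neighborFinset] at hk
    rw [dist_eq_one_iff_adj.mpr hk.symm]
  rw [Finset.sum_congr rfl hcongr, Finset.sum_const, card_neighborFinset_eq_degree, nsmul_eq_mul]

/-- At distance `d + 1` from `j`, the gate contributes `d` and the other `deg i - 1` neighbours `d +
2` each. At `i = j` there is no gate, whence the correction `-2`. -/
theorem lapRow_dotProduct_dist {i : V} (hi : ∀ j, i ≠ j → U.HasGate i j) (j : V) :
    lapRow U i ⬝ᵥ (fun k => (U.dist k j : ℝ)) =
      2 - U.degree i - if i = j then 2 else 0 := by
  rw [lapRow_dotProduct]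
  by_cases hij : i = j
  · subst hij
    rw [sum_neighbors_self i fun d => (d : ℝ)]
    simp
  · obtain ⟨d, hd, hsum⟩ := (hi j hij).sum_neighbors fun d => (d : ℝ)
    rw [hsum, hd, if_neg hij]
    push_cast
    ring

/-- The same count with squares; here the case `i = j` needs no correction, since its linear term
vanishes. -/
theorem lapRow_dotProduct_dist_sq {i : V} (hi : ∀ j, i ≠ j → U.HasGate i j) (j : V) :
    lapRow U i ⬝ᵥ (fun k => (U.dist k j : ℝ) ^ 2) =
      2 * (2 - U.degree i) * U.dist i j - U.degree i := by
  rw [lapRow_dotProduct]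
  by_cases hij : i = j
  · subst hij
    rw [sum_neighbors_self i fun d => (d : ℝ) ^ 2]
    simp
  · obtain ⟨d, hd, hsum⟩ := (hi j hij).sum_neighbors fun d => (d : ℝ) ^ 2
    rw [hsum, hd]
    push_cast
    ring

theorem distSqMatrix_mulVec_lapRow {i : V} (hi : ∀ j, i ≠ j → U.HasGate i j) :
    distSqMatrix U *ᵥ lapRow U i =
      fun j => 2 * (2 - U.degree i) * (U.dist j i : ℝ) - U.degree i := by
  ext j
  rw [SimpleGraph.dist_comm, ← lapRow_dotProduct_dist_sq hi j, mulVec, dotProduct_comm]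
  congr 1
  ext k
  rw [distSqMatrix, of_apply, SimpleGraph.dist_comm]

theorem lapRow_gram {i j : V} (hi : ∀ k, i ≠ k → U.HasGate i k)
    (hj : ∀ k, j ≠ k → U.HasGate j k) :
    lapRow U i ⬝ᵥ distSqMatrix U *ᵥ lapRow U j =
      2 * (2 - U.degree j) * (2 - U.degree i - if i = j then 2 else 0) := by
  rw [distSqMatrix_mulVec_lapRow hj, ← lapRow_dotProduct_dist hi j]
  have h := sum_lapRow (U := U) i
  simp only [dotProduct, mul_sub, Finset.sum_sub_distrib, ← Finset.sum_mul, h, zero_mul, sub_zero,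
    Finset.mul_sum]
  exact Finset.sum_congr rfl fun k _ => by ring

end LaplacianRows

/-! ### Gram matrices in the cycle-with-tree graph -/

namespace IsCycleTreeModel

open Matrix SimpleGraph

variable {V : Type*} [Fintype V] [DecidableEq V] {U : SimpleGraph V} [DecidableRel U.Adj]
  {m : ℕ} {γ : ℕ → V} {T : Finset V} {w : V}

set_option linter.unusedSectionVars false

theorem cycle_notMem (h : IsCycleTreeModel U m γ T w) {k : ℕ} (hk : k ≤ 2 * m) (hm : 2 ≤ m) :
    γ k ∉ T := by
  rcases hk.lt_or_eq with hk | rfl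
  · exact (h.notMem_iff _).mpr ⟨k, hk, rfl⟩
  · rw [h.period]
    exact (h.notMem_iff _).mpr ⟨0, by omega, rfl⟩

theorem cycle_ne (h : IsCycleTreeModel U m γ T w) {a b : ℕ} (hab : a < b) (hb : b ≤ 2 * m)
    (hlt : b - a < 2 * m) : γ a ≠ γ b := by
  intro he
  have h1 := h.isometric a b hab.le hb
  rw [he, dist_self] at h1
  omega

theorem dist_zero (h : IsCycleTreeModel U m γ T w) {a : ℕ} (ha : a ≤ 2 * m) :
    U.dist (γ 0) (γ a) = min a (2 * m - a) := by
  simpa using h.isometric 0 a (Nat.zero_le _) ha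

theorem dist_cycle (h : IsCycleTreeModel U m γ T w) (hm : 2 ≤ m) {i : V} (hi : i ∈ T) {a : ℕ}
    (ha : a ≤ 2 * m) : U.dist i (γ a) = U.dist i w + 1 + min a (2 * m - a) := by
  rw [h.dist_eq i hi _ (h.cycle_notMem ha hm), h.dist_zero ha]

theorem card_le (h : IsCycleTreeModel U m γ T w) : Fintype.card V ≤ 2 * m + T.card := by
  have h1 : Tᶜ ⊆ (Finset.range (2 * m)).image γ := fun x hx => by
    obtain ⟨k, hk, rfl⟩ := (h.notMem_iff x).mp (Finset.mem_compl.mp hx)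
    exact Finset.mem_image_of_mem _ (Finset.mem_range.mpr hk)
  have h2 := Finset.card_le_card h1
  have h3 := (Finset.card_image_le (s := Finset.range (2 * m)) (f := γ))
  rw [Finset.card_compl, Finset.card_range] at *
  omega

/-- The sum of the Laplacian rows of the vertices of the tree. -/
noncomputable def treeSum (U : SimpleGraph V) [DecidableRel U.Adj] (T : Finset V) : V → ℝ :=
  ∑ i ∈ T, lapRow U i

/-- The sum is the Laplacian applied to the indicator of `T`, and only the bridge leaves `T`. -/
theorem treeSum_eq (h : IsCycleTreeModel U m γ T w) (hm : 2 ≤ m) :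
    treeSum U T = Pi.single w 1 - Pi.single (γ 0) 1 := by
  have h0 : γ 0 ∉ T := h.cycle_notMem (by omega) hm
  have hw := h.mem_root
  have hne : w ≠ γ 0 := fun e => h0 (e ▸ hw)
  ext x
  have h1 : treeSum U T x = lapRow U x ⬝ᵥ fun i => if i ∈ T then 1 else 0 := by
    simp only [treeSum, dotProduct, mul_ite, mul_one, mul_zero, Finset.sum_ite_mem,
      Finset.univ_inter]
    rw [Finset.sum_apply]
    exact Finset.sum_congr rfl fun i _ => (U.isSymm_lapMatrix (R := ℝ)).apply _ _
  rw [h1, lapRow_dotProduct, ← card_neighborFinset_eq_degree, ← nsmul_eq_mul, ← Finset.sum_const,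
    ← Finset.sum_sub_distrib]
  by_cases hx : x ∈ T
  · have h2 (k : V) (hk : k ∈ U.neighborFinset x) :
        ((if x ∈ T then 1 else 0) - (if k ∈ T then 1 else 0) : ℝ) =
          if k = γ 0 then 1 else 0 := by
      rw [mem_neighborFinset] at hk
      by_cases hkT : k ∈ T
      · simp [hx, hkT, show k ≠ γ 0 from fun e => h0 (e ▸ hkT)]
      · simp [hx, h0, ((h.adj_iff k hkT x hx).mp hk.symm).1]
    rw [Finset.sum_congr rfl h2, Finset.sum_ite_eq']
    simp only [mem_neighborFinset, U.adj_comm x, h.adj_iff _ h0 _ hx, true_and]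
    have hx0 : x ≠ γ 0 := fun e => h0 (e ▸ hx)
    simp [Pi.single_apply, hx0]
  · have h2 (k : V) (hk : k ∈ U.neighborFinset x) :
        ((if x ∈ T then 1 else 0) - (if k ∈ T then 1 else 0) : ℝ) =
          if k = w then -1 else 0 := by
      rw [mem_neighborFinset] at hk
      by_cases hkT : k ∈ T
      · simp [hx, ((h.adj_iff x hx k hkT).mp hk).2, hw]
      · simp [hx, hkT, show k ≠ w from fun e => hkT (e ▸ hw)]
    rw [Finset.sum_congr rfl h2, Finset.sum_ite_eq']
    simp only [mem_neighborFinset, h.adj_iff _ hx _ hw, and_true]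
    have hxw : x ≠ w := fun e => hx (e ▸ hw)
    by_cases hx0 : x = γ 0
    · simp [hx0, hne.symm]
    · simp [hx0, hxw]

/-- Pair `treeSum` with the distance to `γ 0`: each row contributes `2 - deg i`, while `e_w - e_{γ
0}` gives `1`. -/
theorem sum_two_sub_degree (h : IsCycleTreeModel U m γ T w) (hm : 2 ≤ m) :
    ∑ i ∈ T, (2 - U.degree i : ℝ) = 1 := by
  have h0 : γ 0 ∉ T := h.cycle_notMem (by omega) hm
  have h1 : treeSum U T ⬝ᵥ (fun k => (U.dist k (γ 0) : ℝ)) = 1 := by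
    have := h.dist_cycle hm h.mem_root (a := 0) (by omega)
    rw [h.treeSum_eq hm, sub_dotProduct]
    simp [this]
  rw [← h1, treeSum, sum_dotProduct]
  refine Finset.sum_congr rfl fun i hi => ?_
  rw [lapRow_dotProduct_dist (h.hasGate i hi), if_neg fun e : i = γ 0 => h0 (e ▸ hi), sub_zero]

theorem treeSum_lapRow_gram (h : IsCycleTreeModel U m γ T w) (hm : 2 ≤ m) {i : V} (hi : i ∈ T) :
    treeSum U T ⬝ᵥ distSqMatrix U *ᵥ lapRow U i = -2 * (2 - U.degree i) := by
  rw [treeSum, sum_dotProduct, Finset.sum_congr rfl fun j hj =>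
    lapRow_gram (h.hasGate j hj) (h.hasGate i hi), ← Finset.mul_sum, Finset.sum_sub_distrib,
    h.sum_two_sub_degree hm, Finset.sum_ite_eq', if_pos hi]
  ring

theorem treeSum_gram (h : IsCycleTreeModel U m γ T w) (hm : 2 ≤ m) :
    treeSum U T ⬝ᵥ distSqMatrix U *ᵥ treeSum U T = -2 := by
  conv_lhs => rw [treeSum, mulVec_sum, ← treeSum, dotProduct_sum]
  rw [Finset.sum_congr rfl fun i hi => h.treeSum_lapRow_gram hm hi, ← Finset.mul_sum,
    h.sum_two_sub_degree hm, mul_one]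

theorem sum_treeSum (T : Finset V) : ∑ j, treeSum U T j = 0 := by
  simp only [treeSum, Finset.sum_apply]
  rw [Finset.sum_comm]
  exact Finset.sum_eq_zero fun i _ => sum_lapRow i

/-- Seen from the tree, edge `k` ascends and its antipode descends, so the slopes add in the odd
flow; they cancel in the even flow. -/
theorem oddFlow_lapRow_gram (h : IsCycleTreeModel U m γ T w) (hm : 2 ≤ m) {i : V} (hi : i ∈ T)
    {k : ℕ} (hk : k < m) :
    oddFlow γ m k ⬝ᵥ distSqMatrix U *ᵥ lapRow U i = 4 * (2 - U.degree i) := by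
  rw [distSqMatrix_mulVec_lapRow (h.hasGate i hi), oddFlow_dotProduct]
  simp only [U.dist_comm (v := i)]
  rw [h.dist_cycle hm hi (by omega), h.dist_cycle hm hi (by omega), h.dist_cycle hm hi (by omega),
    h.dist_cycle hm hi (by omega)]
  obtain ⟨s, rfl⟩ := Nat.exists_eq_add_of_lt hk
  rw [show min (k + 1) (2 * (k + s + 1) - (k + 1)) = k + 1 by omega,
    show min k (2 * (k + s + 1) - k) = k by omega,
    show min (k + (k + s + 1) + 1) (2 * (k + s + 1) - (k + (k + s + 1) + 1)) = s by omega,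
    show min (k + (k + s + 1)) (2 * (k + s + 1) - (k + (k + s + 1))) = s + 1 by omega]
  push_cast
  ring

theorem evenFlow_lapRow_gram (h : IsCycleTreeModel U m γ T w) (hm : 2 ≤ m) {i : V} (hi : i ∈ T)
    {k : ℕ} (hk : k < m) : evenFlow γ m k ⬝ᵥ distSqMatrix U *ᵥ lapRow U i = 0 := by
  rw [distSqMatrix_mulVec_lapRow (h.hasGate i hi), evenFlow_dotProduct]
  simp only [U.dist_comm (v := i)]
  rw [h.dist_cycle hm hi (by omega), h.dist_cycle hm hi (by omega), h.dist_cycle hm hi (by omega),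
    h.dist_cycle hm hi (by omega)]
  obtain ⟨s, rfl⟩ := Nat.exists_eq_add_of_lt hk
  rw [show min (k + 1) (2 * (k + s + 1) - (k + 1)) = k + 1 by omega,
    show min k (2 * (k + s + 1) - k) = k by omega,
    show min (k + (k + s + 1) + 1) (2 * (k + s + 1) - (k + (k + s + 1) + 1)) = s by omega,
    show min (k + (k + s + 1)) (2 * (k + s + 1) - (k + (k + s + 1))) = s + 1 by omega]
  push_cast
  ring

theorem oddFlow_treeSum_gram (h : IsCycleTreeModel U m γ T w) (hm : 2 ≤ m) {k : ℕ} (hk : k < m) :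
    oddFlow γ m k ⬝ᵥ distSqMatrix U *ᵥ treeSum U T = 4 := by
  rw [treeSum, mulVec_sum, dotProduct_sum, Finset.sum_congr rfl fun i hi =>
    h.oddFlow_lapRow_gram hm hi hk, ← Finset.mul_sum, h.sum_two_sub_degree hm, mul_one]

/-- The odd vectors of the cycle, made orthogonal to the Laplacian rows of the tree. -/
noncomputable def oddVec (U : SimpleGraph V) [DecidableRel U.Adj] (γ : ℕ → V) (m : ℕ)
    (T : Finset V) (k : ℕ) : V → ℝ :=
  oddFlow γ m k + (2 : ℝ) • treeSum U T

theorem oddVec_gram (h : IsCycleTreeModel U m γ T w) (hm : 2 ≤ m) {k l : ℕ} (hk : k < m)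
    (hl : l < m) :
    oddVec U γ m T k ⬝ᵥ distSqMatrix U *ᵥ oddVec U γ m T l =
      8 + if k = l then -(8 * (m : ℝ)) else 0 := by
  simp only [oddVec, mulVec_add, mulVec_smul, add_dotProduct, dotProduct_add, smul_dotProduct,
    dotProduct_smul, smul_eq_mul]
  rw [quadForm_comm (distSqMatrix_isSymm U) (treeSum U T) (oddFlow γ m l),
    h.oddFlow_treeSum_gram hm hk, h.oddFlow_treeSum_gram hm hl, h.treeSum_gram hm,
    oddFlow_gram h.isometric hm hk hl]
  ring

/-- The coefficient `2` in `oddVec` is forced by `4(2 - deg i) + 2 · (-2)(2 - deg i) = 0`. -/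
theorem oddVec_lapRow_gram (h : IsCycleTreeModel U m γ T w) (hm : 2 ≤ m) {i : V} (hi : i ∈ T)
    {k : ℕ} (hk : k < m) : oddVec U γ m T k ⬝ᵥ distSqMatrix U *ᵥ lapRow U i = 0 := by
  rw [oddVec, add_dotProduct, smul_dotProduct, h.oddFlow_lapRow_gram hm hi hk,
    h.treeSum_lapRow_gram hm hi, smul_eq_mul]
  ring

theorem oddVec_treeSum_gram (h : IsCycleTreeModel U m γ T w) (hm : 2 ≤ m) {k : ℕ} (hk : k < m) :
    oddVec U γ m T k ⬝ᵥ distSqMatrix U *ᵥ treeSum U T = 0 := by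
  rw [treeSum, mulVec_sum, dotProduct_sum]
  exact Finset.sum_eq_zero fun i hi => h.oddVec_lapRow_gram hm hi hk

/-- A vector of coordinate sum zero whose image under the distance squared matrix is constant. -/
noncomputable def pole (γ : ℕ → V) (m : ℕ) (w : V) : V → ℝ :=
  Pi.single (γ 0) 1 - Pi.single (γ m) 1 + (m : ℝ) • (Pi.single (γ 0) 1 - Pi.single w 1)

theorem sum_pole (γ : ℕ → V) (m : ℕ) (w : V) : ∑ j, pole γ m w j = 0 := by
  simp [pole, Finset.sum_add_distrib, ← Finset.mul_sum]

/-- `oddVec_gram` gives `8J - 8mI`, degenerate along the sum of the `m` odd vectors; that sum is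
`-2` times `pole`, which suggests this vector. -/
theorem distSqMatrix_mulVec_pole (h : IsCycleTreeModel U m γ T w) (hm : 2 ≤ m) :
    distSqMatrix U *ᵥ pole γ m w = fun _ => -((m : ℝ) * (m + 1)) := by
  ext j
  have h1 : (distSqMatrix U *ᵥ pole γ m w) j = (U.dist j (γ 0) : ℝ) ^ 2 - (U.dist j (γ m) : ℝ) ^ 2
      + m * ((U.dist j (γ 0) : ℝ) ^ 2 - (U.dist j w : ℝ) ^ 2) := by
    simp [pole, mulVec_add, mulVec_sub, mulVec_smul, distSqMatrix]
  rw [h1]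
  by_cases hj : j ∈ T
  · rw [h.dist_cycle hm hj (by omega), h.dist_cycle hm hj (by omega),
      show min 0 (2 * m - 0) = 0 by omega, show min m (2 * m - m) = m by omega]
    push_cast
    ring
  · obtain ⟨a, ha, rfl⟩ := (h.notMem_iff j).mp hj
    rw [U.dist_comm (v := w), h.dist_cycle hm h.mem_root ha.le, dist_self,
      U.dist_comm (v := γ 0), h.dist_zero ha.le]
    rcases le_total a m with ham | ham
    · rw [h.isometric a m ham (by omega)]
      obtain ⟨s, rfl⟩ := Nat.exists_eq_add_of_le ham
      rw [show min a (2 * (a + s) - a) = a by omega,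
        show min (a + s - a) (2 * (a + s) - (a + s - a)) = s by omega]
      push_cast
      ring
    · rw [U.dist_comm, h.isometric m a ham (by omega)]
      obtain ⟨s, rfl⟩ := Nat.exists_eq_add_of_le ham
      obtain ⟨r, rfl⟩ := Nat.exists_eq_add_of_lt (show s < m by omega)
      rw [show min (s + r + 1 + s) (2 * (s + r + 1) - (s + r + 1 + s)) = r + 1 by omega,
        show min (s + r + 1 + s - (s + r + 1)) (2 * (s + r + 1) - (s + r + 1 + s - (s + r + 1))) = s
          by omega]
      push_cast
      ring

/-! ### The three inertia bounds -/

theorem le_negInertia (h : IsCycleTreeModel U m γ T w) (hm : 2 ≤ m) :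
    m + (T.filter fun i => U.degree i = 1).card ≤ negInertia (distSqMatrix U) := by
  have hm' : (0 : ℝ) < m := by positivity
  -- Leaf rows alone have Gram matrix `2J - 4I`, in general not negative definite; adding `treeSum`
  -- turns it into `-4J - 4I` and keeps orthogonality to the odd vectors.
  let b : Fin (m - 1) ⊕ {i // i ∈ T.filter fun i => U.degree i = 1} → V → ℝ :=
    Sum.elim (fun k => oddVec U γ m T k) fun i => lapRow U i + treeSum U T
  have hk (k : Fin (m - 1)) : (k : ℕ) < m := k.2.trans_le (by omega)
  have h11 (i j : Fin (m - 1)) : b (.inl i) ⬝ᵥ distSqMatrix U *ᵥ b (.inl j) =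
      8 + if i = j then -(8 * (m : ℝ)) else 0 := by
    simp only [Fin.ext_iff]
    exact h.oddVec_gram hm (hk i) (hk j)
  have h12 (i : Fin (m - 1)) (j : {i // i ∈ T.filter fun i => U.degree i = 1}) :
      b (.inl i) ⬝ᵥ distSqMatrix U *ᵥ b (.inr j) = 0 := by
    obtain ⟨j, hj⟩ := j
    rw [Finset.mem_filter] at hj
    change oddVec U γ m T i ⬝ᵥ distSqMatrix U *ᵥ (lapRow U j + treeSum U T) = 0
    rw [mulVec_add, dotProduct_add, h.oddVec_lapRow_gram hm hj.1 (hk i),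
      h.oddVec_treeSum_gram hm (hk i), add_zero]
  have h22 (i j : {i // i ∈ T.filter fun i => U.degree i = 1}) :
      b (.inr i) ⬝ᵥ distSqMatrix U *ᵥ b (.inr j) = -4 + if i = j then -4 else 0 := by
    obtain ⟨i, hi⟩ := i
    obtain ⟨j, hj⟩ := j
    rw [Finset.mem_filter] at hi hj
    change (lapRow U i + treeSum U T) ⬝ᵥ distSqMatrix U *ᵥ (lapRow U j + treeSum U T) = _
    rw [mulVec_add, dotProduct_add, add_dotProduct, add_dotProduct,
      quadForm_comm (distSqMatrix_isSymm U) (lapRow U i) (treeSum U T),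
      h.treeSum_gram hm, h.treeSum_lapRow_gram hm hi.1, h.treeSum_lapRow_gram hm hj.1,
      lapRow_gram (h.hasGate i hi.1) (h.hasGate j hj.1), hi.2, hj.2]
    by_cases hij : i = j <;> simp [hij] <;> norm_num
  have hb (i) : ∑ j, b i j = 0 := by
    rcases i with k | i
    · simp [b, oddVec, Finset.sum_add_distrib, ← Finset.mul_sum, sum_oddFlow, sum_treeSum]
    · simp [b, Finset.sum_add_distrib, sum_treeSum, sum_lapRow]
  have := card_add_one_le_negInertia (κ := (m : ℝ) * (m + 1)) (u := Pi.single (γ 0) 1)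
    (distSqMatrix_isSymm U) (by positivity) (h.distSqMatrix_mulVec_pole hm) (sum_pole γ m w)
    (by simp) (by simp [distSqMatrix]) b hb fun a ha => by
      simp only [Fintype.sum_sum_type, h11, h12, h22,
        quadForm_comm (distSqMatrix_isSymm U) (b (.inr _)) (b (.inl _)), mul_zero,
        Finset.sum_const_zero, add_zero, zero_add]
      rw [sum_delta_form, sum_delta_form]
      have e1 := sq_sum_le_card_mul_sum_sq (s := Finset.univ) (f := fun i => a (.inl i))
      have e2 : 0 ≤ ∑ i, a (.inl i) ^ 2 := Finset.sum_nonneg fun i _ => sq_nonneg _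
      have e3 : 0 ≤ ∑ i, a (.inr i) ^ 2 := Finset.sum_nonneg fun i _ => sq_nonneg _
      have e4 : (((m - 1 : ℕ) : ℝ)) = m - 1 := by rw [Nat.cast_sub (by omega), Nat.cast_one]
      have e5 := sum_sq_pos_of_ne_zero ha
      rw [Fintype.sum_sum_type] at e5
      rw [Finset.card_univ, Fintype.card_fin, e4] at e1
      have e6 := sq_nonneg (∑ i, a (.inr i))
      linarith
  simp only [Fintype.card_sum, Fintype.card_fin, Fintype.card_coe] at this
  omega

theorem le_posInertia (h : IsCycleTreeModel U m γ T w) (hm : 2 ≤ m) :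
    m + (T.filter fun i => 3 ≤ U.degree i).card ≤ posInertia (distSqMatrix U) := by
  have hm' : (0 : ℝ) < m := by positivity
  let b : Fin (m - 1) ⊕ {i // i ∈ T.filter fun i => 3 ≤ U.degree i} → V → ℝ :=
    Sum.elim (fun k => evenFlow γ m k) fun i => lapRow U i
  have hk (k : Fin (m - 1)) : (k : ℕ) < m := k.2.trans_le (by omega)
  have h11 (i j : Fin (m - 1)) : b (.inl i) ⬝ᵥ distSqMatrix U *ᵥ b (.inl j) =
      -8 + if i = j then 8 * (m : ℝ) else 0 := by
    simp only [Fin.ext_iff]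
    exact evenFlow_gram h.isometric hm (hk i) (hk j)
  have h12 (i : Fin (m - 1)) (j : {i // i ∈ T.filter fun i => 3 ≤ U.degree i}) :
      b (.inl i) ⬝ᵥ distSqMatrix U *ᵥ b (.inr j) = 0 :=
    h.evenFlow_lapRow_gram hm (Finset.mem_filter.mp j.2).1 (hk i)
  have h22 (i j : {i // i ∈ T.filter fun i => 3 ≤ U.degree i}) :
      b (.inr i) ⬝ᵥ distSqMatrix U *ᵥ b (.inr j) =
        2 * (2 - U.degree (j : V)) * (2 - U.degree (i : V) - if i = j then 2 else 0) := by
    simp only [Subtype.ext_iff]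
    exact lapRow_gram (h.hasGate _ (Finset.mem_filter.mp i.2).1)
      (h.hasGate _ (Finset.mem_filter.mp j.2).1)
  have hb (i) : ∑ j, b i j = 0 := by
    rcases i with k | i
    · exact sum_evenFlow γ m k
    · exact sum_lapRow _
  have := card_add_one_le_posInertia (κ := (m : ℝ) * (m + 1)) (u := Pi.single (γ 0) 1)
    (distSqMatrix_isSymm U) (by positivity) (h.distSqMatrix_mulVec_pole hm) (sum_pole γ m w)
    (by simp) (by simp [distSqMatrix]) b hb fun a ha => by
      simp only [Fintype.sum_sum_type, h11, h12, h22,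
        quadForm_comm (distSqMatrix_isSymm U) (b (.inr _)) (b (.inl _)), mul_zero,
        Finset.sum_const_zero, add_zero, zero_add]
      rw [sum_delta_form]
      -- The Gram matrix is a positive multiple of a rank-one square plus a diagonal with entries
      -- `4(deg i - 2) > 0`.
      have e0 : ∑ i, ∑ j, a (.inr i) * a (.inr j) * (2 * (2 - U.degree (j : V)) *
          (2 - U.degree (i : V) - if i = j then 2 else 0) : ℝ) =
          2 * (∑ i : {i // i ∈ T.filter fun i => 3 ≤ U.degree i},
              (2 - U.degree (i : V)) * a (.inr i)) ^ 2 +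
            ∑ i : {i // i ∈ T.filter fun i => 3 ≤ U.degree i},
              4 * ((U.degree (i : V) : ℝ) - 2) * a (.inr i) ^ 2 := by
        rw [sq, Finset.sum_mul_sum, Finset.mul_sum, ← Finset.sum_add_distrib]
        refine Finset.sum_congr rfl fun i _ => ?_
        rw [Finset.mul_sum]
        simp only [mul_sub _ _ (ite _ _ _), mul_ite, mul_zero, Finset.sum_sub_distrib,
          Finset.sum_ite_eq, Finset.mem_univ, if_true]
        rw [sub_eq_add_neg]
        congr 1
        · exact Finset.sum_congr rfl fun j _ => by ring
        · ring
      rw [e0]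
      have e1 := sq_sum_le_card_mul_sum_sq (s := Finset.univ) (f := fun i => a (.inl i))
      have e2 : 0 ≤ ∑ i, a (.inl i) ^ 2 := Finset.sum_nonneg fun i _ => sq_nonneg _
      have e3 : ∑ i, a (.inr i) ^ 2 ≤ ∑ i : {i // i ∈ T.filter fun i => 3 ≤ U.degree i},
          4 * ((U.degree (i : V) : ℝ) - 2) * a (.inr i) ^ 2 := by
        refine Finset.sum_le_sum fun i _ => ?_
        have : (3 : ℝ) ≤ U.degree (i : V) := by exact_mod_cast (Finset.mem_filter.mp i.2).2
        exact le_mul_of_one_le_left (sq_nonneg _) (by linarith)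
      have e3' : 0 ≤ ∑ i, a (.inr i) ^ 2 := Finset.sum_nonneg fun i _ => sq_nonneg _
      have e4 : (((m - 1 : ℕ) : ℝ)) = m - 1 := by rw [Nat.cast_sub (by omega), Nat.cast_one]
      have e5 := sum_sq_pos_of_ne_zero ha
      rw [Fintype.sum_sum_type] at e5
      rw [Finset.card_univ, Fintype.card_fin, e4] at e1
      have e6 := sq_nonneg (∑ i : {i // i ∈ T.filter fun i => 3 ≤ U.degree i},
        (2 - U.degree (i : V) : ℝ) * a (.inr i))
      linarith
  simp only [Fintype.card_sum, Fintype.card_fin, Fintype.card_coe] at this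
  omega

theorem le_zeroInertia (h : IsCycleTreeModel U m γ T w) (hm : 2 ≤ m) :
    (T.filter fun i => U.degree i = 2).card ≤ zeroInertia (distSqMatrix U) := by
  have hκ : (m : ℝ) * (m + 1) ≠ 0 := by positivity
  have h0m : γ 0 ≠ γ m := h.cycle_ne (by omega) (by omega) (by omega)
  have hmT : γ m ∉ T := h.cycle_notMem (by omega) hm
  have hmw : γ m ≠ w := fun e => hmT (e ▸ h.mem_root)
  -- For degree 2, `Δ L_i = -2`, while `Δ` sends `pole` to `-κ` with `κ = m(m + 1)`; this
  -- combination cancels the constants.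
  let b : {i // i ∈ T.filter fun i => U.degree i = 2} → V → ℝ :=
    fun i => ((m : ℝ) * (m + 1)) • lapRow U i - (2 : ℝ) • pole γ m w
  rw [← Fintype.card_coe]
  refine card_le_zeroInertia (isHermitian_of_isSymm (distSqMatrix_isSymm U)) b (fun i => ?_) ?_
  · obtain ⟨i, hi⟩ := i
    rw [Finset.mem_filter] at hi
    simp only [b, mulVec_sub, mulVec_smul, h.distSqMatrix_mulVec_pole hm,
      distSqMatrix_mulVec_lapRow (h.hasGate i hi.1), hi.2]
    ext j
    simp
    ring
  · rw [Fintype.linearIndependent_iff]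
    intro a ha
    have hpair (y : V → ℝ) : ∑ i, a i * (((m : ℝ) * (m + 1)) * (lapRow U i ⬝ᵥ y)
        - 2 * (pole γ m w ⬝ᵥ y)) = 0 := by
      have := congrArg (· ⬝ᵥ y) ha
      simpa [b, sum_dotProduct, sub_dotProduct, smul_dotProduct] using this
    have hL (i : {i // i ∈ T.filter fun i => U.degree i = 2}) :
        lapRow U i ⬝ᵥ Pi.single (γ m) 1 = 0 := by
      have hiT := (Finset.mem_filter.mp i.2).1
      have hne : γ m ≠ i := fun e => hmT (e ▸ hiT)
      have hna : ¬ U.Adj i (γ m) := fun hadj =>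
        h0m ((h.adj_iff _ hmT _ hiT).mp hadj.symm).1.symm
      simp [lapRow, lapMatrix, degMatrix, adjMatrix_apply, hna, diagonal_apply_ne' _ hne]
    have hx : pole γ m w ⬝ᵥ Pi.single (γ m) 1 = -1 := by
      simp [pole, h0m.symm, hmw]
    -- The coordinate at `γ m` sees only the `pole` terms. Once they cancel, pairing with the
    -- distance to `j` isolates `a j`.
    have hsum : ∑ i, a i = 0 := by
      have := hpair (Pi.single (γ m) 1)
      simp only [hL, hx, mul_zero, zero_sub, ← Finset.sum_mul] at this
      linarith
    intro j
    have := hpair fun k => (U.dist k j : ℝ)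
    have hL' (i : {i // i ∈ T.filter fun i => U.degree i = 2}) :
        lapRow U i ⬝ᵥ (fun k => (U.dist k j : ℝ)) = -if i = j then 2 else 0 := by
      obtain ⟨hiT, hi⟩ := Finset.mem_filter.mp i.2
      rw [lapRow_dotProduct_dist (h.hasGate _ hiT), hi]
      simp only [Subtype.ext_iff]
      norm_num
    simp only [hL', mul_sub, Finset.sum_sub_distrib, ← Finset.sum_mul, hsum, zero_mul, sub_zero,
      mul_neg, mul_ite, mul_zero, Finset.sum_neg_distrib, Finset.sum_ite_eq', Finset.mem_univ,
      if_true, neg_eq_zero] at this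
    rcases mul_eq_zero.mp this with h1 | h1
    · exact h1
    · exact absurd h1 (mul_ne_zero hκ two_ne_zero)

theorem degree_pos (h : IsCycleTreeModel U m γ T w) (hm : 2 ≤ m) {i : V} (hi : i ∈ T) :
    0 < U.degree i := by
  obtain ⟨k, hk, -⟩ := h.hasGate i hi (γ 0) fun e => h.cycle_notMem (by omega) hm (e ▸ hi)
  exact (U.degree_pos_iff_exists_adj i).mpr ⟨k, hk⟩

theorem inertia_eq (h : IsCycleTreeModel U m γ T w) (hm : 2 ≤ m) :
    negInertia (distSqMatrix U) = (T.filter fun i => U.degree i = 1).card + m ∧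
      zeroInertia (distSqMatrix U) = (T.filter fun i => U.degree i = 2).card := by
  have h1 := h.le_negInertia hm
  have h2 := h.le_posInertia hm
  have h3 := h.le_zeroInertia hm
  have h4 := h.card_le
  have h5 := negInertia_add_zeroInertia_add_posInertia
    (isHermitian_of_isSymm (distSqMatrix_isSymm U))
  have h6 : T ⊆ (T.filter fun i => U.degree i = 1) ∪ (T.filter fun i => U.degree i = 2) ∪
      (T.filter fun i => 3 ≤ U.degree i) := fun i hi => by
    have := h.degree_pos hm hi
    simp only [Finset.mem_union, Finset.mem_filter, hi, true_and]
    omega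
  have h7 := (Finset.card_le_card h6).trans ((Finset.card_union_le _ _).trans
    (Nat.add_le_add_right (Finset.card_union_le _ _) _))
  omega

end IsCycleTreeModel

/-! ### Leaves and degree 2 cut vertices -/

namespace IsCycleTreeModel

open SimpleGraph

variable {V : Type*} [Fintype V] [DecidableEq V] {U : SimpleGraph V} [DecidableRel U.Adj]
  {m : ℕ} {γ : ℕ → V} {T : Finset V} {w : V}

theorem three_le_degree_zero (h : IsCycleTreeModel U m γ T w) (hm : 2 ≤ m) :
    3 ≤ U.degree (γ 0) := by
  have h0 : γ 0 ∉ T := h.cycle_notMem (by omega) hm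
  have hw := h.mem_root
  have hne (k : ℕ) (hk : k ≤ 2 * m) : γ k ≠ w := fun e => h.cycle_notMem hk hm (e ▸ hw)
  have hlast : U.Adj (γ 0) (γ (2 * m - 1)) := by
    have := h.adj_succ (2 * m - 1)
    rw [show 2 * m - 1 + 1 = 2 * m by omega, h.period] at this
    exact this.symm
  have hsub : ({γ 1, γ (2 * m - 1), w} : Finset V) ⊆ U.neighborFinset (γ 0) := by
    simp only [Finset.insert_subset_iff, Finset.singleton_subset_iff, mem_neighborFinset]
    exact ⟨h.adj_succ 0, hlast, (h.adj_iff _ h0 _ hw).mpr ⟨rfl, rfl⟩⟩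
  have := Finset.card_le_card hsub
  rwa [card_neighborFinset_eq_degree, Finset.card_eq_three.mpr
    ⟨_, _, _, h.cycle_ne (by omega) (by omega) (by omega), hne 1 (by omega),
      hne (2 * m - 1) (by omega), rfl⟩] at this

theorem two_le_degree (h : IsCycleTreeModel U m γ T w) (hm : 2 ≤ m) {c : V} (hc : c ∉ T) :
    2 ≤ U.degree c := by
  obtain ⟨k, hk, rfl⟩ := (h.notMem_iff c).mp hc
  rcases k with _ | k
  · exact (h.three_le_degree_zero hm).trans' (by omega)
  · have hsub : ({γ k, γ (k + 2)} : Finset V) ⊆ U.neighborFinset (γ (k + 1)) := by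
      simp only [Finset.insert_subset_iff, Finset.singleton_subset_iff, mem_neighborFinset]
      exact ⟨(h.adj_succ k).symm, h.adj_succ (k + 1)⟩
    have := Finset.card_le_card hsub
    rwa [card_neighborFinset_eq_degree, Finset.card_pair
      (h.cycle_ne (by omega) (by omega) (by omega))] at this

/-- Each remaining cycle vertex reaches `γ 0` along the arc avoiding `γ k`, and the tree hangs on `γ
0`, which survives because `0 < k < 2m`. -/
theorem preconnected_induce_compl_cycle (h : IsCycleTreeModel U m γ T w) (hm : 2 ≤ m) {k : ℕ}
    (hk0 : 0 < k) (hk : k < 2 * m) : (U.induce {γ k}ᶜ).Preconnected := by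
  have hkT : γ k ∉ T := h.cycle_notMem hk.le hm
  have h0 : γ 0 ∈ ({γ k}ᶜ : Set V) := h.cycle_ne hk0 hk.le (by omega)
  have hw : w ∈ ({γ k}ᶜ : Set V) := fun e => hkT (e ▸ h.mem_root)
  have step {x y : V} (hx : x ∈ ({γ k}ᶜ : Set V)) (hy : y ∈ ({γ k}ᶜ : Set V)) (hxy : U.Adj x y) :
      (U.induce {γ k}ᶜ).Reachable ⟨x, hx⟩ ⟨y, hy⟩ :=
    Adj.reachable (by simpa using hxy)
  have hlow (a : ℕ) : a < k → ∀ ha : γ a ∈ ({γ k}ᶜ : Set V),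
      (U.induce {γ k}ᶜ).Reachable ⟨γ 0, h0⟩ ⟨γ a, ha⟩ := by
    induction a with
    | zero => exact fun _ _ => Reachable.rfl
    | succ a ih =>
      intro hak ha
      have ha' : γ a ∈ ({γ k}ᶜ : Set V) := h.cycle_ne (by omega) hk.le (by omega)
      exact (ih (by omega) ha').trans (step ha' ha (h.adj_succ a))
  have hhigh (n : ℕ) : k < 2 * m - n → ∀ hn : γ (2 * m - n) ∈ ({γ k}ᶜ : Set V),
      (U.induce {γ k}ᶜ).Reachable ⟨γ 0, h0⟩ ⟨γ (2 * m - n), hn⟩ := by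
    induction n with
    | zero =>
      intro _ hn
      rw [show (⟨γ (2 * m - 0), hn⟩ : ({γ k}ᶜ : Set V)) = ⟨γ 0, h0⟩ from Subtype.ext h.period]
    | succ n ih =>
      intro hkn hn
      have hn' : γ (2 * m - n) ∈ ({γ k}ᶜ : Set V) :=
        (h.cycle_ne (by omega) (by omega) (by omega)).symm
      have hadj := h.adj_succ (2 * m - (n + 1))
      rw [show 2 * m - (n + 1) + 1 = 2 * m - n by omega] at hadj
      exact (ih (by omega) hn').trans (step hn' hn hadj.symm)
  have hall (x : V) (hx : x ∈ ({γ k}ᶜ : Set V)) :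
      (U.induce {γ k}ᶜ).Reachable ⟨γ 0, h0⟩ ⟨x, hx⟩ := by
    by_cases hxT : x ∈ T
    · refine (step h0 hw ((h.adj_iff _ (h.cycle_notMem (by omega) hm) _ h.mem_root).mpr
        ⟨rfl, rfl⟩)).trans (h.reachable_root _ hkT x hxT hx hw).symm
    · obtain ⟨a, ha, rfl⟩ := (h.notMem_iff x).mp hxT
      rcases lt_trichotomy a k with hak | rfl | hak
      · exact hlow a hak hx
      · exact absurd rfl hx
      · obtain ⟨n, hn⟩ := Nat.exists_eq_add_of_lt ha
        have hn' : a = 2 * m - (n + 1) := by omega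
        subst hn'
        exact hhigh (n + 1) hak hx
  intro x y
  exact (hall x x.2).symm.trans (hall y y.2)

/-- For the neighbours `a`, `b` of `i`, the gate property makes `d(b, j) - d(a, j)` equal to `2` or
`-2` for all `j ≠ i`. Along an edge it changes by at most `2`, so its sign is constant on walks
avoiding `i`, yet it differs at `a` and `b`. -/
theorem not_preconnected_induce_compl (h : IsCycleTreeModel U m γ T w) {i : V} (hi : i ∈ T)
    (hdeg : U.degree i = 2) : ¬ (U.induce {i}ᶜ).Preconnected := by
  intro hpre
  rw [← card_neighborFinset_eq_degree, Finset.card_eq_two] at hdeg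
  obtain ⟨a, b, hab, hN⟩ := hdeg
  have hadj (k : V) : U.Adj i k ↔ k = a ∨ k = b := by
    rw [← mem_neighborFinset, hN, Finset.mem_insert, Finset.mem_singleton]
  have ha : U.Adj i a := (hadj a).mpr (.inl rfl)
  have hb : U.Adj i b := (hadj b).mpr (.inr rfl)
  have hdich (j : V) (hij : i ≠ j) :
      U.dist b j = U.dist a j + 2 ∨ U.dist a j = U.dist b j + 2 := by
    obtain ⟨k, hk, hd, hall⟩ := h.hasGate i hi j hij
    rcases (hadj k).mp hk with rfl | rfl
    · have := hall b hb hab.symm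
      omega
    · have := hall a ha hab
      omega
  have hclosed {x y : ({i}ᶜ : Set V)} (p : (U.induce {i}ᶜ).Walk x y)
      (hx : U.dist b x = U.dist a x + 2) : U.dist b y = U.dist a y + 2 := by
    induction p with
    | nil => exact hx
    | @cons x z y hxz p ih =>
      refine ih ?_
      have hxz' : U.Adj x z := by simpa using hxz
      have h1 := h.connected.dist_le_dist_add_one hxz' a
      have h2 := h.connected.dist_le_dist_add_one hxz'.symm b
      have := hdich z fun e => z.2 e.symm
      omega
  obtain ⟨p⟩ := hpre ⟨a, ha.ne'⟩ ⟨b, hb.ne'⟩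
  have h1 := hdich a ha.ne
  have h2 := hclosed p (by
    simp only [dist_self] at h1 ⊢
    omega)
  simp only [dist_self] at h2
  omega

theorem numLeaves_eq (h : IsCycleTreeModel U m γ T w) (hm : 2 ≤ m) :
    numLeaves U = (T.filter fun i => U.degree i = 1).card := by
  rw [numLeaves, ← Set.ncard_coe_finset]
  congr 1
  ext x
  simp only [Set.mem_ofPred_eq, Finset.coe_filter]
  refine ⟨fun hx => ⟨?_, hx⟩, fun hx => hx.2⟩
  by_contra hxT
  have := h.two_le_degree hm hxT
  omega

theorem numDegreeTwoCutVertices_eq (h : IsCycleTreeModel U m γ T w) (hm : 2 ≤ m) :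
    numDegreeTwoCutVertices U = (T.filter fun i => U.degree i = 2).card := by
  rw [numDegreeTwoCutVertices, ← Set.ncard_coe_finset]
  congr 1
  ext x
  simp only [Set.mem_ofPred_eq, Finset.coe_filter]
  refine ⟨fun hx => ⟨?_, hx.1⟩, fun hx => ⟨hx.2, h.not_preconnected_induce_compl hx.1 hx.2⟩⟩
  by_contra hxT
  obtain ⟨k, hk, rfl⟩ := (h.notMem_iff x).mp hxT
  rcases Nat.eq_zero_or_pos k with rfl | hk0
  · have := h.three_le_degree_zero hm
    omega
  · exact hx.2 (h.preconnected_induce_compl_cycle hm hk0 hk)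

end IsCycleTreeModel

theorem mainTheorem1 {V : Type*} [Fintype V] [DecidableEq V]
    (U : SimpleGraph V) [DecidableRel U.Adj] (p : ℕ) (hp : Even p)
    (hU : IsCycleWithTree U p) :
    negInertia (distSqMatrix U) =
        numLeaves U + negInertia (distSqMatrix (SimpleGraph.cycleGraph p)) ∧
      negInertia (distSqMatrix (SimpleGraph.cycleGraph p)) = p / 2 ∧
      zeroInertia (distSqMatrix U) = numDegreeTwoCutVertices U := by
  obtain ⟨m, rfl⟩ := hp
  rw [← two_mul] at hU ⊢
  have hm : 2 ≤ m := by have := hU.1; omega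
  obtain ⟨γ, T, w, h⟩ := hU.exists_model
  obtain ⟨hneg, hzero⟩ := h.inertia_eq hm
  rw [negInertia_distSqMatrix_cycleGraph hm, h.numLeaves_eq hm, h.numDegreeTwoCutVertices_eq hm]
  exact ⟨hneg, by omega, hzero⟩
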